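/- Let $G$ be a finite simple graph. In the hat guessing game $(G,h,g)$, with integers $h,g\ge 1$, a hat of one of $h$ colors is put on each vertex of $G$; each vertex sees exactly the colors on its neighbors and, by a deterministic strategy fixed in advance, guesses a set of exactly $g$ colors. The game is winning if there is a strategy such that, for every assignment of colors, at least one vertex has its own color among its guesses. The fractional hat chromatic number of $G$ is $$\hat\mu(G)=\sup\Bigl\{\tfrac hg : (G,h,g)\text{ is winning}\Bigr\}.$$ A graph is chordal if every cycle of length at least $4$ has a chord. There is an algorithm $\mathcal A$ which, given a chordal graph $G$ on $n\ge 1$ vertices (as its adjacency matrix) and an integer $k\ge 1$, outputs a rational number $t$ with $|t-\hat\mu(G)|\le 2^{-k}$. Its running time is $2k\cdot\mathrm{poly}(n)$: it is a program of a random access machine with exact rational arithmetic, and there are polynomials $p,q$ such that on every such input it halts after at most $2k\cdot p(n)$ elementary steps (arithmetic operations $+,-,\cdot,/$, comparisons, and memory accesses), while every number that it computes has a numerator and denominator (in lowest terms) with at most $k\cdot q(n)$ binary digits in total. Moreover, if $\hat\mu(G)$ is rational, then $\hat\mu(G)$ is an integer, and $\mathcal A$ outputs its exact value $t=\hat\mu(G)$.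 -/

import Mathlib

namespace HatGuessing

/-! ### The game and the fractional hat chromatic number -/

/-- Every cycle of length at least 4 has a chord: an edge of the graph that joins two vertices of
the cycle and is not an edge of the cycle. -/
def IsChordal {V : Type*} (G : SimpleGraph V) : Prop :=
  ∀ (v : V) (c : G.Walk v v), c.IsCycle → 4 ≤ c.length →
    ∃ x ∈ c.support, ∃ y ∈ c.support, G.Adj x y ∧ s(x, y) ∉ c.edges

/-- A strategy for the game `(G, h, g)`: the bear on `v` sees the colors of the hats on the
neighbors of `v` and guesses a set of exactly `g` of the `h` colors. -/
def Strategy {V : Type*} (G : SimpleGraph V) (h g : ℕ) : Type _ :=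
  (v : V) → (G.neighborSet v → Fin h) → {A : Finset (Fin h) // A.card = g}

/-- For every hats arrangement at least one bear guesses correctly. -/
def Strategy.IsWinning {V : Type*} {G : SimpleGraph V} {h g : ℕ} (Γ : Strategy G h g) : Prop :=
  ∀ φ : V → Fin h, ∃ v : V, φ v ∈ (Γ v (fun u => φ u)).val

/-- The hat guessing game `(G, h, g)` is winning. -/
def IsWinningGame {V : Type*} (G : SimpleGraph V) (h g : ℕ) : Prop :=
  ∃ Γ : Strategy G h g, Γ.IsWinning

/-- The fractional hat chromatic number: the supremum of `h / g` over all winning games. -/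
noncomputable def fracHatNumber {V : Type*} (G : SimpleGraph V) : ℝ :=
  sSup {x : ℝ | ∃ h g : ℕ, 0 < h ∧ 0 < g ∧ IsWinningGame G h g ∧ x = (h : ℝ) / g}

/-! ### Algorithms

Programs of a random access machine with exact rational arithmetic. A program is a fixed finite
text. It uses registers and arrays, both named by natural numbers, whose entries are rationals.
One arithmetic operation, comparison, assignment, array read or array write is one step. The
semantics also keeps track of the size of the numbers that are computed. -/

/-- The arithmetic operations. -/
inductive Op
  | add
  | sub
  | mul
  | div

/-- The value of an arithmetic operation; a division by zero returns zero. -/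
def Op.eval : Op → ℚ → ℚ → ℚ
  | .add, a, b => a + b
  | .sub, a, b => a - b
  | .mul, a, b => a * b
  | .div, a, b => a / b

/-- Programs. -/
inductive Prog
  /-- do nothing -/
  | skip
  /-- `x := q` -/
  | const (x : ℕ) (q : ℚ)
  /-- `x := y o z` -/
  | arith (o : Op) (x y z : ℕ)
  /-- `x := a[i]`, where `a` is the name of an array and `i` is a register -/
  | load (x a i : ℕ)
  /-- `a[i] := x`, where `a` is the name of an array and `i` is a register -/
  | store (a i x : ℕ)
  /-- first `P`, then `Q` -/
  | seq (P Q : Prog)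
  /-- if `x < y` then `P` else `Q` -/
  | ite (x y : ℕ) (P Q : Prog)
  /-- while `x < y` do `P` -/
  | loop (x y : ℕ) (P : Prog)

/-- The state of the memory. -/
structure State where
  /-- contents of the registers -/
  reg : ℕ → ℚ
  /-- `arr a i` is entry `i` of the array `a` -/
  arr : ℕ → ℕ → ℚ

/-- Write `q` into register `x`. -/
def State.setReg (s : State) (x : ℕ) (q : ℚ) : State :=
  { s with reg := Function.update s.reg x q }

/-- Write `q` into entry `i` of the array `a`. -/
def State.setArr (s : State) (a i : ℕ) (q : ℚ) : State :=
  { s with arr := Function.update s.arr a (Function.update (s.arr a) i q) }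

/-- The number of binary digits of numerator and denominator of a rational in lowest terms. -/
def bitLength (q : ℚ) : ℕ :=
  q.num.natAbs.size + q.den.size

/-- `Run b P s t s'`: started in the state `s`, the program `P` halts in the state `s'` after
exactly `t` steps, and every number that it writes on the way has bit length at most `b`. An array
index `r` that is not a natural number is rounded down (to `0` if `r` is negative). -/
inductive Run (b : ℕ) : Prog → State → ℕ → State → Prop
  | skip (s : State) : Run b .skip s 1 s
  | const (x : ℕ) (q : ℚ) (s : State) (hb : bitLength q ≤ b) :
      Run b (.const x q) s 1 (s.setReg x q)
  | arith (o : Op) (x y z : ℕ) (s : State) (hb : bitLength (o.eval (s.reg y) (s.reg z)) ≤ b) :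
      Run b (.arith o x y z) s 1 (s.setReg x (o.eval (s.reg y) (s.reg z)))
  | load (x a i : ℕ) (s : State) (hb : bitLength (s.arr a ⌊s.reg i⌋₊) ≤ b) :
      Run b (.load x a i) s 1 (s.setReg x (s.arr a ⌊s.reg i⌋₊))
  | store (a i x : ℕ) (s : State) (hb : bitLength (s.reg x) ≤ b) :
      Run b (.store a i x) s 1 (s.setArr a ⌊s.reg i⌋₊ (s.reg x))
  | seq {P Q : Prog} {s s' s'' : State} {t t' : ℕ} (hP : Run b P s t s') (hQ : Run b Q s' t' s'') :
      Run b (.seq P Q) s (t + t') s''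
  | ite_true {x y : ℕ} {P Q : Prog} {s s' : State} {t : ℕ} (h : s.reg x < s.reg y)
      (hP : Run b P s t s') : Run b (.ite x y P Q) s (t + 1) s'
  | ite_false {x y : ℕ} {P Q : Prog} {s s' : State} {t : ℕ} (h : ¬ s.reg x < s.reg y)
      (hQ : Run b Q s t s') : Run b (.ite x y P Q) s (t + 1) s'
  | loop_false {x y : ℕ} {P : Prog} {s : State} (h : ¬ s.reg x < s.reg y) :
      Run b (.loop x y P) s 1 s
  | loop_true {x y : ℕ} {P : Prog} {s s' s'' : State} {t t' : ℕ} (h : s.reg x < s.reg y)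
      (hP : Run b P s t s') (hL : Run b (.loop x y P) s' t' s'') :
      Run b (.loop x y P) s (t + t' + 1) s''

open Classical in
/-- The initial memory for the input `(G, k)`: register 0 holds the number `n` of vertices,
register 1 holds `k`, array 0 holds the adjacency matrix of `G` row by row, and everything else is
zero. -/
noncomputable def input {n : ℕ} (G : SimpleGraph (Fin n)) (k : ℕ) : State where
  reg x := if x = 0 then (n : ℚ) else if x = 1 then (k : ℚ) else 0
  arr a i := if a = 0 ∧ ∃ u v : Fin n, G.Adj u v ∧ i = n * (u : ℕ) + (v : ℕ) then 1 else 0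

/-- The output of a computation that halts in the state `s` is the content of register 0. -/
def State.output (s : State) : ℚ :=
  s.reg 0

end HatGuessing

/-! Give every vertex the weight `x = g / h`, the fraction of the colors that it guesses. A chordal
graph has a perfect elimination order (Dirac). Eliminating a vertex `v` that is simplicial among the
remaining vertices divides the weights of its neighbors by `1 - w v`; `x` is feasible if every
vertex has weight below `1` at its turn.

If `x` is feasible, the bears lose. The number of arrangements in which all bears of a set are wrong
is a supermodular function of the set, and adding a bear that sees no one in the set costs at most a
fraction `x`. Conditioning on a simplicial vertex being wrong preserves this structure with the new
weights, so the count stays positive (`pos_of_supermodular`). If `x` is infeasible, the bears win: a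
strategy for the reweighted game extends to `v` by splitting the bets on a sum of residues over the
clique of `v` and its remaining neighbors (`winsOn_cons`). As feasibility is an open condition, `y ≤
fracHatNumber G` holds exactly when `1 / y` is infeasible (`le_fracHatNumber_iff`).

The signed independence polynomial factors along the elimination, so one minus a current weight is a
quotient of two of its values. This keeps the numbers short. It also gives integrality: if the hat
number is a rational `r`, then `1 / r` is a root of such a polynomial of an initial segment, which
has integer coefficients and constant coefficient `1`; hence `r` is a root of a monic integer
polynomial.

The algorithm computes an order, finds the integer part by `n` feasibility tests (the hat number
lies between `1` and `n`), and bisects `k` times. The output is the hat number rounded down to a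
multiple of `1 / 2 ^ k`, which is exact on integers. -/

namespace HatGuessing

/-! ### Simplicial vertices of chordal graphs -/

section Chordal

variable {V : Type*} {G : SimpleGraph V}

/-- A walk that realizes the distance of its ends is chordless. -/
theorem isChordless_of_length_eq_dist {s t : V} (p : G.Walk s t) (hp : p.length = G.dist s t) :
    p.IsChordless := by
  classical
  rw [SimpleGraph.Walk.isChordless_iff_forall_mem_edges]
  have key : ∀ {a b : V} (q : G.Walk a b), q.IsSubwalk p → G.Adj a b → s(a, b) ∈ p.edges := by
    intro a b q hq hab
    have h1 := SimpleGraph.length_eq_dist_of_subwalk hp hq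
    rw [SimpleGraph.dist_eq_one_iff_adj.2 hab] at h1
    cases q with
    | nil => simp at h1
    | cons h q =>
      cases q with
      | nil => exact hq.edges_subset (by simp)
      | cons h' q => simp at h1
  intro x y hx hy hxy
  rw [← p.take_spec hx, SimpleGraph.Walk.mem_support_append_iff] at hy
  rcases hy with hy | hy
  · rw [Sym2.eq_swap]
    exact key ((p.takeUntil x hx).dropUntil y hy)
      (((p.takeUntil x hx).isSubwalk_dropUntil hy).trans (p.isSubwalk_takeUntil hx)) hxy.symm
  · exact key ((p.dropUntil x hx).takeUntil y hy)
      (((p.dropUntil x hx).isSubwalk_takeUntil hy).trans (p.isSubwalk_dropUntil hx)) hxy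

/-- The graph on the same vertices that keeps only the edges inside `W`. -/
def restrict (G : SimpleGraph V) (W : Set V) : SimpleGraph V where
  Adj a b := G.Adj a b ∧ a ∈ W ∧ b ∈ W
  symm := ⟨fun _ _ h => ⟨h.1.symm, h.2.2, h.2.1⟩⟩
  loopless := ⟨fun _ h => h.1.ne rfl⟩

theorem restrict_le (G : SimpleGraph V) (W : Set V) : restrict G W ≤ G := fun _ _ h => h.1

theorem restrict_mono (G : SimpleGraph V) {W W' : Set V} (h : W ⊆ W') :
    restrict G W ≤ restrict G W' := fun _ _ hab => ⟨hab.1, h hab.2.1, h hab.2.2⟩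

theorem reachable_restrict {W : Set V} {a b : V} (h : G.Adj a b) (ha : a ∈ W) (hb : b ∈ W) :
    (restrict G W).Reachable a b :=
  SimpleGraph.Adj.reachable (G := restrict G W) ⟨h, ha, hb⟩

theorem mem_of_mem_support_restrict {W : Set V} {s t : V} (p : (restrict G W).Walk s t)
    (hs : s ∈ W) {x : V} (hx : x ∈ p.support) : x ∈ W := by
  induction p with
  | nil => simp_all
  | cons h p ih =>
    rcases List.mem_cons.1 (by simpa using hx) with rfl | hx
    · exact hs
    · exact ih h.2.2 hx

/-- In a chordal graph, two neighbors of `v` that are joined through a set of vertices outside the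
closed neighborhood of `v` are adjacent. -/
theorem IsChordal.adj_of_reachable (hG : IsChordal G) {v s t : V} {C : Set V}
    (hC : ∀ c ∈ C, c ≠ v ∧ ¬ G.Adj v c) (hs : G.Adj v s) (ht : G.Adj v t) (hst : s ≠ t)
    (hr : (restrict G (insert s (insert t C))).Reachable s t) : G.Adj s t := by
  classical
  by_contra hna
  set W : Set V := insert s (insert t C) with hW
  have hsW : s ∈ W := by simp [hW]
  have htW : t ∈ W := by simp [hW]
  -- A shortest path from `s` to `t` is chordless and its inner vertices lie in `C`, which `v` does
  -- not see. Closing it through `v` gives a chordless cycle of length at least `4`.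
  obtain ⟨p, hpp, hpd⟩ := hr.exists_path_of_dist
  have hchord := isChordless_of_length_eq_dist p hpd
  have hlen : 2 ≤ p.length := by
    rw [hpd]
    exact hr.one_lt_dist_of_ne_of_not_adj hst (fun h => hna h.1)
  have hvW : v ∉ W := by
    rintro (h | h | h)
    · exact hs.ne h
    · exact ht.ne h
    · exact (hC v h).1 rfl
  have hsup : ∀ x ∈ p.support, x ∈ W := fun x hx => mem_of_mem_support_restrict p hsW hx
  set q := p.mapLe (restrict_le G W) with hq
  have hqs : q.support = p.support := by simp [hq]
  have hqe : q.edges = p.edges := by simp [hq]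
  have hqp : q.IsPath := by simpa [hq] using hpp
  have hvq : v ∉ q.support := fun h => hvW (hsup v (hqs ▸ h))
  set c : G.Walk v v := SimpleGraph.Walk.cons hs (q.concat ht.symm) with hc
  have hcyc : c.IsCycle := by
    rw [hc, SimpleGraph.Walk.cons_isCycle_iff]
    refine ⟨hqp.concat hvq ht.symm, ?_⟩
    rw [SimpleGraph.Walk.edges_concat, List.concat_eq_append, List.mem_append]
    rintro (h | h)
    · exact hvq (q.fst_mem_support_of_mem_edges h)
    · simp only [List.mem_singleton, Sym2.eq_iff] at h
      rcases h with ⟨h, _⟩ | ⟨_, h⟩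
      · exact ht.ne h
      · exact hst h
  have hclen : 4 ≤ c.length := by
    have : q.length = p.length := by simp [hq]
    simp [hc]; omega
  have hce : ∀ e, e ∈ c.edges ↔ e = s(v, s) ∨ e ∈ p.edges ∨ e = s(t, v) := by
    intro e; simp [hc, hqe, SimpleGraph.Walk.edges_concat]
  have hcs : ∀ x, x ∈ c.support ↔ x = v ∨ x ∈ p.support := by
    intro x
    simp only [hc, SimpleGraph.Walk.support_cons, SimpleGraph.Walk.support_concat, hqs,
      List.mem_cons, List.mem_append, List.not_mem_nil, or_false]
    tauto
  have hvx : ∀ y ∈ p.support, G.Adj v y → y = s ∨ y = t := by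
    intro y hy hvy
    rcases hsup y hy with h | h | h
    · exact .inl h
    · exact .inr h
    · exact absurd hvy (hC y h).2
  obtain ⟨x, hx, y, hy, hxy, he⟩ := hG v c hcyc hclen
  rw [hce] at he
  push Not at he
  rcases (hcs x).1 hx with rfl | hxp
  · rcases (hcs y).1 hy with rfl | hyp
    · exact hxy.ne rfl
    · rcases hvx y hyp hxy with rfl | rfl
      · exact he.1 rfl
      · exact he.2.2 Sym2.eq_swap
  · rcases (hcs y).1 hy with rfl | hyp
    · rcases hvx x hxp hxy.symm with rfl | rfl
      · exact he.1 Sym2.eq_swap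
      · exact he.2.2 rfl
    · exact he.2.1 (hchord.mem_edges hxp hyp ⟨hxy, hsup x hxp, hsup y hyp⟩)

/-- The neighbors of `z` in `U` are pairwise adjacent. -/
def IsSimplicialIn (G : SimpleGraph V) (U : Set V) (z : V) : Prop :=
  ∀ a ∈ U, ∀ b ∈ U, G.Adj z a → G.Adj z b → a ≠ b → G.Adj a b

/-- If `v` is not adjacent to all other vertices of `U`, then some vertex of `U` that is not
adjacent to `v` is simplicial in `U`. -/
theorem IsChordal.exists_isSimplicialIn_not_adj (hG : IsChordal G) (U : Finset V) :
    ∀ v ∈ U, (∃ x ∈ U, x ≠ v ∧ ¬ G.Adj v x) →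
      ∃ z ∈ U, z ≠ v ∧ ¬ G.Adj v z ∧ IsSimplicialIn G U z := by
  classical
  induction U using Finset.strongInduction with
  | H U ih =>
  rintro v hv ⟨x₀, hx₀, hx₀v, hx₀a⟩
  -- `C` is the component of `x₀` among the non-neighbors of `v`, and `S` is its boundary. `S`
  -- consists of neighbors of `v`, any two of them joined through `C`, so it is a clique.
  set W : Set V := {x | x ∈ U ∧ x ≠ v ∧ ¬ G.Adj v x} with hW
  set C : Set V := {c | c ∈ W ∧ (restrict G W).Reachable x₀ c} with hCdef
  have hx₀C : x₀ ∈ C := ⟨⟨hx₀, hx₀v, hx₀a⟩, SimpleGraph.Reachable.refl _⟩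
  have hCW : ∀ c ∈ C, c ≠ v ∧ ¬ G.Adj v c := fun c hc => hc.1.2
  set S : Set V := {s | s ∈ U ∧ G.Adj v s ∧ ∃ c ∈ C, G.Adj s c} with hS
  -- neighbors of `C` inside `U` are in `C ∪ S`
  have hnb : ∀ c ∈ C, ∀ a ∈ U, G.Adj c a → a ∈ C ∨ a ∈ S := by
    intro c hc a ha hca
    by_cases hva : G.Adj v a
    · exact .inr ⟨ha, hva, c, hc, hca.symm⟩
    · have hav : a ≠ v := by
        rintro rfl
        exact hc.1.2.2 hca.symm
      have haW : a ∈ W := ⟨ha, hav, hva⟩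
      exact .inl ⟨haW, hc.2.trans (reachable_restrict hca hc.1 haW)⟩
  -- vertices of `C` are connected inside `C`
  have hconn : ∀ c ∈ C, (restrict G C).Reachable x₀ c := by
    rintro c ⟨-, ⟨p⟩⟩
    have : ∀ {a b : V} (q : (restrict G W).Walk a b), a ∈ C → (restrict G C).Reachable a b := by
      intro a b q
      induction q with
      | nil => intro _; exact SimpleGraph.Reachable.refl _
      | @cons a a' b h q ih =>
        intro ha
        have ha' : a' ∈ C := ⟨h.2.2, ha.2.trans (SimpleGraph.Adj.reachable h)⟩
        exact (reachable_restrict h.1 ha ha').trans (ih ha')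
    exact this p hx₀C
  have hclique : ∀ s ∈ S, ∀ t ∈ S, s ≠ t → G.Adj s t := by
    rintro s ⟨-, hvs, c, hc, hsc⟩ t ⟨-, hvt, d, hd, htd⟩ hst
    refine hG.adj_of_reachable hCW hvs hvt hst ?_
    have hsub : C ⊆ insert s (insert t C) := fun c hc => .inr (.inr hc)
    have h1 : (restrict G (insert s (insert t C))).Reachable c d :=
      ((hconn c hc).symm.trans (hconn d hd)).mono (restrict_mono G hsub)
    exact ((reachable_restrict hsc (.inl rfl) (hsub hc)).trans h1).trans
      (reachable_restrict htd.symm (hsub hd) (.inr (.inl rfl)))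
  -- it suffices to find a vertex of `C` that is simplicial in `C ∪ S`
  set U' : Finset V := U.filter (fun x => x ∈ C ∨ x ∈ S) with hU'
  have hCU : ∀ c ∈ C, c ∈ U' := fun c hc => Finset.mem_filter.2 ⟨hc.1.1, .inl hc⟩
  have hSU : ∀ c ∈ S, c ∈ U' := fun c hc => Finset.mem_filter.2 ⟨hc.1, .inr hc⟩
  suffices h : ∃ z ∈ C, IsSimplicialIn G U' z by
    obtain ⟨z, hz, hzs⟩ := h
    refine ⟨z, hz.1.1, hz.1.2.1, hz.1.2.2, fun a ha b hb hza hzb hab => ?_⟩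
    have ha' : a ∈ U' := (hnb z hz a ha hza).elim (hCU a) (hSU a)
    have hb' : b ∈ U' := (hnb z hz b hb hzb).elim (hCU b) (hSU b)
    exact hzs a ha' b hb' hza hzb hab
  have hss : U' ⊂ U := by
    refine Finset.filter_ssubset.2 ⟨v, hv, ?_⟩
    rintro (h | h)
    · exact h.1.2.1 rfl
    · exact h.2.1.ne rfl
  have hmem : ∀ x ∈ U', x ∈ C ∨ x ∈ S := fun x hx => (Finset.mem_filter.1 hx).2
  -- The induction hypothesis yields a simplicial vertex not adjacent to a chosen base vertex. It
  -- avoids `S` if the base is in `S`, a clique, or if all of `S` is adjacent to the rest of `U'`.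
  -- If no base vertex exists, `U'` is a clique.
  by_cases h1 : ∃ s ∈ S, ∃ x ∈ U', x ≠ s ∧ ¬ G.Adj s x
  · obtain ⟨s, hs, hx⟩ := h1
    obtain ⟨z, hz, hzs, hza, hzU⟩ := ih U' hss s (hSU s hs) hx
    refine ⟨z, (hmem z hz).resolve_right fun hzS => hza (hclique s hs z hzS hzs.symm), hzU⟩
  by_cases h2 : ∃ c ∈ C, ∃ x ∈ U', x ≠ c ∧ ¬ G.Adj c x
  · obtain ⟨c, hc, hx⟩ := h2
    obtain ⟨z, hz, hzc, hza, hzU⟩ := ih U' hss c (hCU c hc) hx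
    refine ⟨z, (hmem z hz).resolve_right fun hzS => ?_, hzU⟩
    push Not at h1
    exact hza (h1 z hzS c (hCU c hc) hzc.symm).symm
  · push Not at h1 h2
    refine ⟨x₀, hx₀C, fun a ha b hb _ _ hab => ?_⟩
    rcases hmem a ha with h | h
    · exact h2 a h b hb hab.symm
    · exact h1 a h b hb hab.symm

/-- **Dirac's theorem**: every nonempty set of vertices of a chordal graph has a simplicial
vertex. -/
theorem IsChordal.exists_isSimplicialIn (hG : IsChordal G) (U : Finset V) (hU : U.Nonempty) :
    ∃ z ∈ U, IsSimplicialIn G U z := by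
  by_cases h : ∃ v ∈ U, ∃ x ∈ U, x ≠ v ∧ ¬ G.Adj v x
  · obtain ⟨v, hv, hx⟩ := h
    obtain ⟨z, hz, -, -, hzU⟩ := hG.exists_isSimplicialIn_not_adj U v hv hx
    exact ⟨z, hz, hzU⟩
  · push Not at h
    obtain ⟨z, hz⟩ := hU
    exact ⟨z, hz, fun a ha b hb _ _ hab => h a ha b hb hab.symm⟩

end Chordal

/-! ### Elimination orders and reweighting -/

section Elimination

variable {V : Type*} {G : SimpleGraph V}

/-- A perfect elimination order: every vertex is simplicial among its successors. -/
def IsElimOrder (G : SimpleGraph V) : List V → Prop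
  | [] => True
  | v :: l => v ∉ l ∧ IsSimplicialIn G {x | x ∈ l} v ∧ IsElimOrder G l

/-- Simpliciality passes to smaller sets. This is used for initial segments and for an initial
segment followed by one later vertex. -/
theorem IsElimOrder.sublist {l l' : List V} (h : l'.Sublist l) (hl : IsElimOrder G l) :
    IsElimOrder G l' := by
  induction h with
  | slnil => trivial
  | cons a _ ih => exact ih hl.2.2
  | cons_cons a h ih =>
    exact ⟨fun ha => hl.1 (h.subset ha),
      fun x hx y hy => hl.2.1 x (h.subset hx) y (h.subset hy), ih hl.2.2⟩

open Classical in
/-- The weights that are left after the elimination of `v`. -/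
noncomputable def reweight (G : SimpleGraph V) (v : V) (w : V → ℚ) (u : V) : ℚ :=
  if G.Adj v u then w u / (1 - w v) else w u

/-- Every vertex has weight less than `1` when it is eliminated. -/
def Feasible (G : SimpleGraph V) : List V → (V → ℚ) → Prop
  | [], _ => True
  | v :: l, w => w v < 1 ∧ Feasible G l (reweight G v w)

/-- The weights after the elimination of all vertices of a list. -/
noncomputable def weightAfter (G : SimpleGraph V) : List V → (V → ℚ) → V → ℚ
  | [], w => w
  | v :: l, w => weightAfter G l (reweight G v w)

theorem feasible_append (l₁ l₂ : List V) (w : V → ℚ) :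
    Feasible G (l₁ ++ l₂) w ↔ Feasible G l₁ w ∧ Feasible G l₂ (weightAfter G l₁ w) := by
  induction l₁ generalizing w with
  | nil => simp [Feasible, weightAfter]
  | cons v l ih => simp [Feasible, weightAfter, ih, and_assoc]

theorem weightAfter_append (l₁ l₂ : List V) (w : V → ℚ) :
    weightAfter G (l₁ ++ l₂) w = weightAfter G l₂ (weightAfter G l₁ w) := by
  induction l₁ generalizing w with
  | nil => rfl
  | cons v l ih => simp [weightAfter, ih]

theorem reweight_nonneg {v : V} {w : V → ℚ} (hw : ∀ u, 0 ≤ w u) (hv : w v < 1) (u : V) :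
    0 ≤ reweight G v w u := by
  unfold reweight
  split_ifs
  · exact div_nonneg (hw u) (by linarith)
  · exact hw u

/-! ### The signed independence polynomial -/

open Classical in
/-- The signed independence polynomial of the graph induced by the vertices in the list, evaluated
at the weights `w`. -/
noncomputable def indepVal (G : SimpleGraph V) (w : V → ℚ) : List V → ℚ
  | [] => 1
  | v :: l => indepVal G w l - w v * indepVal G w (l.filter (fun u => ¬ G.Adj v u))
termination_by l => l.length
decreasing_by
  · simp
  · simpa [Nat.lt_succ_iff] using (List.length_filter_le _ l.attach).trans (by simp)

@[simp]
theorem indepVal_nil (w : V → ℚ) : indepVal G w [] = 1 := by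
  rw [indepVal]

open Classical in
theorem indepVal_cons (w : V → ℚ) (v : V) (l : List V) :
    indepVal G w (v :: l) =
      indepVal G w l - w v * indepVal G w (l.filter (fun u => ¬ G.Adj v u)) := by
  rw [indepVal]

open Classical in
theorem length_filter_lt (v u : V) (l : List V) :
    (l.filter (fun u => ¬ G.Adj v u)).length < (u :: l).length := by
  simpa [Nat.lt_succ_iff] using List.length_filter_le _ l

theorem indepVal_congr {w w' : V → ℚ} (l : List V) (h : ∀ u ∈ l, w u = w' u) :
    indepVal G w l = indepVal G w' l := by
  classical
  induction hn : l.length using Nat.strong_induction_on generalizing l with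
  | _ n ih =>
  subst hn
  cases l with
  | nil => simp
  | cons v l =>
    rw [indepVal_cons, indepVal_cons, h v (by simp),
      ih l.length (by simp) l (fun u hu => h u (by simp [hu])) rfl,
      ih _ (length_filter_lt v v l) _
        (fun u hu => h u (List.mem_cons_of_mem _ (List.mem_filter.1 hu).1)) rfl]

open Classical in
/-- Elimination of a simplicial vertex `v`. -/
theorem indepVal_reweight {w : V → ℚ} {v : V} (hv : w v ≠ 1) (l : List V)
    (hs : IsSimplicialIn G {x | x ∈ l} v) (hl : l.Nodup) :
    (1 - w v) * indepVal G (reweight G v w) l =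
      indepVal G w l - w v * indepVal G w (l.filter (fun u => ¬ G.Adj v u)) := by
  have hv' : 1 - w v ≠ 0 := sub_ne_zero.2 hv.symm
  induction hn : l.length using Nat.strong_induction_on generalizing l with
  | _ n ih =>
  subst hn
  cases l with
  | nil => simp
  | cons u l =>
    have hs' : IsSimplicialIn G {x | x ∈ l} v := fun a ha b hb =>
      hs a (List.mem_cons_of_mem _ ha) b (List.mem_cons_of_mem _ hb)
    have hul := (List.nodup_cons.1 hl).1
    have hl' := (List.nodup_cons.1 hl).2
    have ih1 := ih l.length (by simp) l hs' hl' rfl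
    rw [indepVal_cons, indepVal_cons, List.filter_cons]
    by_cases hvu : G.Adj v u
    -- All other neighbors of `v` in the list are neighbors of `u`, since `v` is simplicial, so the
    -- filtered list contains no reweighted vertex.
    · have hre : indepVal G (reweight G v w) (l.filter (fun x => ¬ G.Adj u x)) =
          indepVal G w (l.filter (fun x => ¬ G.Adj u x)) := by
        refine indepVal_congr _ fun x hx => ?_
        rw [List.mem_filter] at hx
        have hux : ¬ G.Adj u x := by simpa using hx.2
        unfold reweight
        rw [if_neg]
        intro hvx
        exact hux (hs u (by simp) x (by simp [hx.1]) hvu hvx (fun h => hul (h ▸ hx.1)))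
      have hwu : reweight G v w u = w u / (1 - w v) := by simp [reweight, hvu]
      rw [hre, mul_sub, ih1, hwu]
      simp only [hvu, not_true_eq_false, decide_false, Bool.false_eq_true, if_false]
      field_simp
      ring
    · have ih2 := ih _ (length_filter_lt u u l) (l.filter (fun x => ¬ G.Adj u x))
        (fun a ha b hb => hs' a (List.mem_filter.1 ha).1 b (List.mem_filter.1 hb).1)
        (hl'.filter _) rfl
      have hwu : reweight G v w u = w u := by simp [reweight, hvu]
      have hcomm : (l.filter (fun x => ¬ G.Adj u x)).filter (fun x => ¬ G.Adj v x) =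
          (l.filter (fun x => ¬ G.Adj v x)).filter (fun x => ¬ G.Adj u x) := by
        rw [List.filter_filter, List.filter_filter]
        congr 1
        funext x
        exact Bool.and_comm _ _
      simp only [hvu, not_false_eq_true, decide_true, if_true]
      rw [indepVal_cons, mul_sub, ih1, hwu, mul_left_comm, ih2, hcomm]
      ring

theorem IsElimOrder.nodup {l : List V} (h : IsElimOrder G l) : l.Nodup := by
  induction l with
  | nil => simp
  | cons v l ih => exact List.nodup_cons.2 ⟨h.1, ih h.2.2⟩

theorem IsElimOrder.indepVal_cons_eq {w : V → ℚ} {v : V} {l : List V}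
    (h : IsElimOrder G (v :: l)) (hv : w v ≠ 1) :
    indepVal G w (v :: l) = (1 - w v) * indepVal G (reweight G v w) l := by
  rw [indepVal_cons, indepVal_reweight hv l h.2.1 h.2.2.nodup]

/-- The value is the product of the factors `1 - w v`, each taken at the moment of the elimination
of `v`. -/
theorem IsElimOrder.indepVal_pos {w : V → ℚ} {l : List V} (h : IsElimOrder G l)
    (hf : Feasible G l w) : 0 < indepVal G w l := by
  induction l generalizing w with
  | nil => simp
  | cons v l ih =>
    rw [h.indepVal_cons_eq hf.1.ne]
    exact mul_pos (by linarith [hf.1]) (ih h.2.2 hf.2)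

/-- Cut the order after the first vertex whose weight has reached `1`: in the product over this
segment, only the last factor fails to be positive. -/
theorem IsElimOrder.exists_initial_indepVal_nonpos {w : V → ℚ} {l : List V} (h : IsElimOrder G l)
    (hf : ¬ Feasible G l w) : ∃ l', l' <+: l ∧ indepVal G w l' ≤ 0 := by
  induction l generalizing w with
  | nil => exact absurd trivial hf
  | cons v l ih =>
    by_cases hv : w v < 1
    · obtain ⟨l', hl', hle⟩ := ih h.2.2 (w := reweight G v w) fun h' => hf ⟨hv, h'⟩
      refine ⟨v :: l', by simpa using hl', ?_⟩
      rw [(h.sublist (hl'.sublist.cons_cons v)).indepVal_cons_eq hv.ne]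
      exact mul_nonpos_of_nonneg_of_nonpos (by linarith) hle
    · refine ⟨[v], by simp, ?_⟩
      rw [indepVal_cons]
      simp only [indepVal_nil, List.filter_nil]
      linarith

/-- The weight of a vertex during the elimination is determined by two values of the signed
independence polynomial. -/
theorem IsElimOrder.indepVal_concat {w : V → ℚ} {l : List V} {u : V}
    (h : IsElimOrder G (l ++ [u])) (hf : Feasible G l w) :
    indepVal G w (l ++ [u]) = indepVal G w l * (1 - weightAfter G l w u) := by
  induction l generalizing w with
  | nil =>
    rw [List.nil_append, indepVal_cons]
    simp [weightAfter]
  | cons v l ih =>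
    rw [List.cons_append] at h ⊢
    rw [h.indepVal_cons_eq hf.1.ne, ih h.2.2 hf.2,
      (h.sublist (by simp : (v :: l).Sublist (v :: (l ++ [u])))).indepVal_cons_eq hf.1.ne]
    simp only [weightAfter]
    ring

/-- At constant weights, `indepVal` is an integer polynomial with constant coefficient `1`. -/
theorem exists_polynomial_indepVal (G : SimpleGraph V) (l : List V) :
    ∃ P : Polynomial ℤ, P.coeff 0 = 1 ∧
      ∀ x : ℚ, indepVal G (fun _ => x) l = Polynomial.aeval x P := by
  classical
  induction hn : l.length using Nat.strong_induction_on generalizing l with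
  | _ n ih =>
  subst hn
  cases l with
  | nil => exact ⟨1, by simp, fun x => by simp⟩
  | cons v l =>
    obtain ⟨P, hP, hP'⟩ := ih l.length (by simp) l rfl
    obtain ⟨Q, hQ, hQ'⟩ := ih _ (length_filter_lt v v l) (l.filter (fun u => ¬ G.Adj v u)) rfl
    refine ⟨P - Polynomial.X * Q, by simp [hP], fun x => ?_⟩
    rw [indepVal_cons, hP', hQ']
    simp

/-- Size of `indepVal` at a constant rational weight. -/
theorem exists_int_indepVal (G : SimpleGraph V) (l : List V) (a b : ℕ) (hb : 0 < b) :
    ∃ N : ℤ, indepVal G (fun _ => (a : ℚ) / b) l * (b : ℚ) ^ l.length = N ∧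
      |N| ≤ ((a + b : ℕ) : ℤ) ^ l.length := by
  classical
  induction hn : l.length using Nat.strong_induction_on generalizing l with
  | _ n ih =>
  subst hn
  cases l with
  | nil => exact ⟨1, by simp, by simp⟩
  | cons v l =>
    obtain ⟨N, hN, hN'⟩ := ih l.length (by simp) l rfl
    obtain ⟨M, hM, hM'⟩ := ih _ (length_filter_lt v v l) (l.filter (fun u => ¬ G.Adj v u)) rfl
    set m := (l.filter (fun u => ¬ G.Adj v u)).length with hm
    have hml : m ≤ l.length := List.length_filter_le _ l
    have hb0 : (b : ℚ) ≠ 0 := by positivity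
    -- The recursion with denominators cleared; the power of `b` compensates for the neighbors of
    -- `v` that the filter removes.
    refine ⟨N * b - a * M * b ^ (l.length - m), ?_, ?_⟩
    · rw [indepVal_cons, List.length_cons]
      push_cast
      rw [← hN, ← hM]
      have hpow : (b : ℚ) ^ l.length = b ^ m * b ^ (l.length - m) := by
        rw [← pow_add]; congr 1; omega
      rw [pow_succ, hpow]
      field_simp
    · have h1 : |N * b - a * M * b ^ (l.length - m)| ≤
          |N| * b + a * (|M| * b ^ (l.length - m)) := by
        refine (abs_sub _ _).trans (le_of_eq ?_)
        simp [abs_mul, abs_pow, mul_assoc]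
      have h2 : |M| * (b : ℤ) ^ (l.length - m) ≤ ((a + b : ℕ) : ℤ) ^ l.length := by
        calc |M| * (b : ℤ) ^ (l.length - m)
            ≤ ((a + b : ℕ) : ℤ) ^ m * ((a + b : ℕ) : ℤ) ^ (l.length - m) := by
              gcongr
              omega
          _ = _ := by rw [← pow_add]; congr 1; omega
      calc _ ≤ _ := h1
        _ ≤ ((a + b : ℕ) : ℤ) ^ l.length * b + a * ((a + b : ℕ) : ℤ) ^ l.length := by gcongr
        _ = _ := by rw [List.length_cons, pow_succ]; push_cast; ring

end Elimination

/-! ### Feasible weights: the bears lose -/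

section Losing

variable {V : Type*} {G : SimpleGraph V}

/-- An abstract form of the local lemma. The induction replaces `N` by `N (insert v ·)`, which
satisfies the same hypotheses for the weights after the elimination of `v`. -/
theorem IsElimOrder.pos_of_supermodular [DecidableEq V] {l : List V} (hl : IsElimOrder G l)
    {w : V → ℚ} (hf : Feasible G l w) (hw : ∀ u, 0 ≤ w u) (N : Finset V → ℚ)
    (hN : ∀ u v W, N (insert u W) + N (insert v W) ≤ N W + N (insert u (insert v W)))
    (hu : ∀ u ∈ l, ∀ W ⊆ l.toFinset, u ∉ W → (∀ x ∈ W, ¬ G.Adj u x) →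
      (1 - w u) * N W ≤ N (insert u W))
    (h0 : 0 < N ∅) : 0 < N l.toFinset := by
  induction l generalizing w N with
  | nil => simpa using h0
  | cons v l ih =>
    rw [List.toFinset_cons]
    have hv1 : 0 < 1 - w v := by linarith [hf.1]
    refine ih hl.2.2 hf.2 (reweight_nonneg hw hf.1) (fun X => N (insert v X)) ?_ ?_ ?_
    · intro a b W
      have := hN a b (insert v W)
      rwa [Finset.insert_comm a v, Finset.insert_comm b v, Finset.insert_comm a v] at this
    · intro u hul W hW huW hna
      have huv : u ≠ v := fun h => hl.1 (h ▸ hul)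
      have hvW : v ∉ W := fun h => hl.1 (List.mem_toFinset.1 (hW h))
      have hW' : W ⊆ (v :: l).toFinset := by
        rw [List.toFinset_cons]; exact hW.trans (Finset.subset_insert _ _)
      show (1 - reweight G v w u) * N (insert v W) ≤ N (insert v (insert u W))
      by_cases hvu : G.Adj v u
      -- By supermodularity, adding `u` after `v` loses at most what adding `u` to `W` loses, that
      -- is `w u * N W`. As `v` is simplicial, `W` contains no neighbor of `v` either, so `N W` is
      -- at most `N (insert v W) / (1 - w v)`.
      · have e1 := hN u v W
        rw [Finset.insert_comm u v] at e1
        have e2 := hu u (by simp [hul]) W hW' huW hna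
        have e3 : (1 - w v) * N W ≤ N (insert v W) := by
          refine hu v (by simp) W hW' hvW fun x hx hvx => ?_
          exact hna x hx (hl.2.1 u hul x (List.mem_toFinset.1 (hW hx)) hvu hvx
            (fun h => huW (h ▸ hx)))
        have hre : reweight G v w u = w u / (1 - w v) := by simp [reweight, hvu]
        have e4 : w u * N W ≤ w u / (1 - w v) * N (insert v W) := by
          rw [div_mul_eq_mul_div, le_div_iff₀ hv1]
          have := mul_le_mul_of_nonneg_left e3 (hw u)
          linarith
        rw [hre]
        linarith
      · have hre : reweight G v w u = w u := by simp [reweight, hvu]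
        rw [hre, Finset.insert_comm]
        refine hu u (by simp [hul]) (insert v W) ?_ ?_ ?_
        · rw [List.toFinset_cons]; exact Finset.insert_subset_insert _ hW
        · simp [huv, huW]
        · intro x hx
          rcases Finset.mem_insert.1 hx with rfl | hx
          · exact fun h => hvu h.symm
          · exact hna x hx
    · have := hu v (by simp) ∅ (by simp) (by simp) (by simp)
      exact lt_of_lt_of_le (mul_pos hv1 h0) (by simpa using this)

variable [Fintype V] {h g : ℕ}

open Classical in
/-- The hats arrangements for which all bears of `X` guess wrong. -/
noncomputable def allWrong (Γ : Strategy G h g) (X : Finset V) : Finset (V → Fin h) :=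
  Finset.univ.filter fun φ => ∀ v ∈ X, φ v ∉ (Γ v (fun u => φ u)).val

theorem mem_allWrong {Γ : Strategy G h g} {X : Finset V} {φ : V → Fin h} :
    φ ∈ allWrong Γ X ↔ ∀ v ∈ X, φ v ∉ (Γ v (fun u => φ u)).val := by
  simp [allWrong]

open Classical in
/-- Given that bears which do not see `u` guess wrong, the bear on `u` is right with frequency
`g / h`. -/
theorem card_allWrong_filter_le (Γ : Strategy G h g) (u : V) (W : Finset V) (huW : u ∉ W)
    (hna : ∀ x ∈ W, ¬ G.Adj u x) :
    h * ((allWrong Γ W).filter fun φ => φ u ∈ (Γ u (fun x => φ x)).val).card ≤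
      g * (allWrong Γ W).card := by
  set E := allWrong Γ W
  have hsee : ∀ (φ : V → Fin h) (c : Fin h),
      Γ u (fun x => Function.update φ u c x) = Γ u (fun x => φ x) := by
    intro φ c
    congr 1
    funext x
    have : (x : V) ≠ u := (x.2 : G.Adj u x).ne'
    simp [this]
  have hE : ∀ (φ : V → Fin h) (c : Fin h), φ ∈ E → Function.update φ u c ∈ E := by
    intro φ c hφ
    rw [mem_allWrong] at hφ ⊢
    intro v hv
    have hvu : v ≠ u := fun e => huW (e ▸ hv)
    have hn : (fun x : G.neighborSet v => Function.update φ u c x) =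
        fun x : G.neighborSet v => φ x := by
      funext x
      have : (x : V) ≠ u := by
        intro e
        exact hna v hv (e ▸ (x.2 : G.Adj v x)).symm
      simp [this]
    rw [hn, Function.update_of_ne hvu]
    exact hφ v hv
  have hcard : (E.sigma fun φ => (Γ u (fun x => φ x)).val).card = g * E.card := by
    rw [Finset.card_sigma]
    simp [(Γ u _).2, mul_comm]
  rw [← hcard]
  have : h * (E.filter fun φ => φ u ∈ (Γ u (fun x => φ x)).val).card =
      ((E.filter fun φ => φ u ∈ (Γ u (fun x => φ x)).val) ×ˢ
        (Finset.univ : Finset (Fin h))).card := by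
    rw [Finset.card_product, Finset.card_fin, mul_comm]
  rw [this]
  -- Recolor `u` arbitrarily and remember its old color. Neither the bears of `W` nor the bear on
  -- `u` see the change, so `W` stays wrong and the old color is still among the guesses of `u`.
  refine Finset.card_le_card_of_injOn (fun q => ⟨Function.update q.1 u q.2, q.1 u⟩) ?_ ?_
  · rintro ⟨φ, c⟩ hq
    simp only [Finset.coe_product, Set.mem_prod, Finset.mem_coe, Finset.mem_filter] at hq
    simp only [Finset.mem_coe, Finset.mem_sigma]
    refine ⟨hE φ c hq.1.1, ?_⟩
    rw [hsee]
    exact hq.1.2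
  · rintro ⟨φ, c⟩ - ⟨ψ, d⟩ - hq
    simp only [Sigma.mk.injEq, heq_eq_eq] at hq
    have hc : c = d := by
      have := congrFun hq.1 u
      simpa using this
    have hφ : φ = ψ := by
      funext x
      by_cases hx : x = u
      · rw [hx]; exact hq.2
      · have := congrFun hq.1 x
        simpa [hx] using this
    rw [hc, hφ]

theorem card_allWrong_insert [DecidableEq V] (Γ : Strategy G h g) (u : V) (W : Finset V)
    (huW : u ∉ W) (hna : ∀ x ∈ W, ¬ G.Adj u x) (hh : 0 < h) :
    (1 - (g : ℚ) / h) * (allWrong Γ W).card ≤ (allWrong Γ (insert u W)).card := by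
  classical
  have h1 := card_allWrong_filter_le Γ u W huW hna
  have h2 := Finset.card_filter_add_card_filter_not (s := allWrong Γ W)
    (fun φ => φ u ∈ (Γ u (fun x => φ x)).val)
  have h3 : (allWrong Γ W).filter (fun φ => φ u ∉ (Γ u (fun x => φ x)).val) =
      allWrong Γ (insert u W) := by
    ext φ
    simp only [Finset.mem_filter, mem_allWrong, Finset.forall_mem_insert]
    tauto
  rw [h3] at h2
  have hh' : (0 : ℚ) < h := by exact_mod_cast hh
  have h1' : (h : ℚ) * ((allWrong Γ W).filter fun φ => φ u ∈ (Γ u (fun x => φ x)).val).card ≤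
      g * (allWrong Γ W).card := by exact_mod_cast h1
  have h2' : (((allWrong Γ W).filter fun φ => φ u ∈ (Γ u (fun x => φ x)).val).card : ℚ) +
      (allWrong Γ (insert u W)).card = (allWrong Γ W).card := by exact_mod_cast h2
  have h4 : (((allWrong Γ W).filter fun φ => φ u ∈ (Γ u (fun x => φ x)).val).card : ℚ) ≤
      (g : ℚ) / h * (allWrong Γ W).card := by
    rw [div_mul_eq_mul_div, le_div_iff₀ hh']
    linarith
  linarith

/-- Inclusion-exclusion: the two sets on the left lie in `allWrong Γ W`, and in their intersection
all of `u`, `v` and `W` are wrong. -/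
theorem card_allWrong_supermodular [DecidableEq V] (Γ : Strategy G h g) (u v : V) (W : Finset V) :
    (allWrong Γ (insert u W)).card + (allWrong Γ (insert v W)).card ≤
      (allWrong Γ W).card + (allWrong Γ (insert u (insert v W))).card := by
  classical
  rw [← Finset.card_union_add_card_inter]
  gcongr
  · intro φ
    simp only [Finset.mem_union, mem_allWrong, Finset.forall_mem_insert]
    tauto
  · intro φ
    simp only [Finset.mem_inter, mem_allWrong, Finset.forall_mem_insert]
    tauto

theorem IsElimOrder.not_isWinningGame {l : List V} (hl : IsElimOrder G l) (hall : ∀ v, v ∈ l)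
    {x : ℚ} (hx : 0 ≤ x) (hf : Feasible G l fun _ => x) (hh : 0 < h) (hg : (g : ℚ) / h ≤ x) :
    ¬ IsWinningGame G h g := by
  classical
  rintro ⟨Γ, hΓ⟩
  have : Nonempty (Fin h) := ⟨⟨0, hh⟩⟩
  have hpos := hl.pos_of_supermodular hf (fun _ => hx) (fun X => ((allWrong Γ X).card : ℚ))
    (fun u v W => by exact_mod_cast card_allWrong_supermodular Γ u v W)
    (fun u _ W _ huW hna => by
      refine le_trans ?_ (card_allWrong_insert Γ u W huW hna hh)
      gcongr)
    (by
      have : allWrong Γ ∅ = Finset.univ := by ext φ; simp [mem_allWrong]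
      rw [this]
      exact_mod_cast Finset.card_pos.2 Finset.univ_nonempty)
  obtain ⟨φ, hφ⟩ := Finset.card_pos.1 (by exact_mod_cast hpos)
  obtain ⟨v, hv⟩ := hΓ φ
  exact mem_allWrong.1 hφ v (List.mem_toFinset.2 (hall v)) hv

/-- The union bound. -/
theorem IsWinningGame.le_card_mul (hwin : IsWinningGame G h g) (hh : 0 < h) :
    h ≤ Fintype.card V * g := by
  classical
  obtain ⟨Γ, hΓ⟩ := hwin
  have : Nonempty (Fin h) := ⟨⟨0, hh⟩⟩
  have h0 : allWrong Γ ∅ = Finset.univ := by ext φ; simp [mem_allWrong]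
  have hcov : (Finset.univ : Finset (V → Fin h)) ⊆ Finset.univ.biUnion fun u =>
      (allWrong Γ ∅).filter fun φ => φ u ∈ (Γ u (fun x => φ x)).val := by
    intro φ _
    obtain ⟨v, hv⟩ := hΓ φ
    simp only [Finset.mem_biUnion, Finset.mem_filter, h0, Finset.mem_univ, true_and]
    exact ⟨v, hv⟩
  have hle := (Finset.card_le_card hcov).trans Finset.card_biUnion_le
  have hpos : 0 < (Finset.univ : Finset (V → Fin h)).card :=
    Finset.card_pos.2 Finset.univ_nonempty
  have hsum : h * (Finset.univ : Finset (V → Fin h)).card ≤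
      (Fintype.card V * g) * (Finset.univ : Finset (V → Fin h)).card := by
    refine (Nat.mul_le_mul_left h hle).trans ?_
    rw [Finset.mul_sum]
    refine (Finset.sum_le_card_nsmul _ _ (g * (Finset.univ : Finset (V → Fin h)).card)
      fun u _ => ?_).trans (by simp [mul_assoc])
    simpa only [h0] using card_allWrong_filter_le Γ u ∅ (by simp) (by simp)
  exact Nat.le_of_mul_le_mul_right hsum hpos

end Losing

/-! ### Infeasible weights: the bears win -/

section Winning

variable {V : Type*} {G : SimpleGraph V}

/-- There is a color set and a strategy for the bears on the vertices of `l`, where the bear on `v`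
guesses at most the fraction `w v` of all colors, such that some bear of `l` always guesses
correctly. -/
def WinsOn (G : SimpleGraph V) (l : List V) (w : V → ℚ) : Prop :=
  ∃ (C : Type) (_ : Fintype C) (_ : Nonempty C) (Γ : V → (V → C) → Finset C),
    (∀ v ∈ l, ∀ φ ψ : V → C, (∀ u, G.Adj v u → φ u = ψ u) → Γ v φ = Γ v ψ) ∧
    (∀ v ∈ l, ∀ φ, ((Γ v φ).card : ℚ) ≤ w v * Fintype.card C) ∧
    ∀ φ, ∃ v ∈ l, φ v ∈ Γ v φ

/-- One color suffices, since `v` may guess everything. -/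
theorem winsOn_cons_of_one_le {v : V} {l : List V} {w : V → ℚ} (hw : ∀ u, 0 ≤ w u)
    (hv : 1 ≤ w v) : WinsOn G (v :: l) w := by
  classical
  refine ⟨Unit, inferInstance, inferInstance, fun u _ => if u = v then Finset.univ else ∅,
    fun _ _ _ _ _ => rfl, fun u _ φ => ?_, fun φ => ⟨v, by simp, by simp⟩⟩
  by_cases h : u = v
  · subst h; simpa using hv
  · simpa [h] using hw u

/-- Add to each color a residue mod `b`, where `w v = a / b`. The vertex `v` and its neighbors in
`l` form a clique; let `σ` be the sum of its residues. The bear on `v` bets that `σ` lies in a set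
`T` of `a` residues. The neighbors play the old strategy on the first component and bet that `σ`
lies outside `T`, which scales their guesses by `1 - w v` and cancels the reweighting. Each member
of the clique sees all other summands, so a bet on `σ` is a bet on its own residue. -/
theorem winsOn_cons {v : V} {l : List V} {w : V → ℚ} (hl : IsElimOrder G (v :: l))
    (hw : ∀ u, 0 ≤ w u) (hv : w v < 1) (hwin : WinsOn G l (reweight G v w)) :
    WinsOn G (v :: l) w := by
  classical
  obtain ⟨C, _, _, Γ, hloc, hcard, hwin⟩ := hwin
  set b := (w v).den with hb
  have hbpos : 0 < b := (w v).den_pos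
  have : NeZero b := ⟨hbpos.ne'⟩
  have hb' : (0 : ℚ) < b := by exact_mod_cast hbpos
  obtain ⟨a, ha⟩ : ∃ a : ℕ, w v * b = a := by
    refine ⟨(w v).num.toNat, ?_⟩
    have h1 : ((w v).num.toNat : ℤ) = (w v).num := Int.toNat_of_nonneg (Rat.num_nonneg.2 (hw v))
    have h2 : (((w v).num.toNat : ℤ) : ℚ) = (w v).num := by rw [h1]
    rw [hb, Rat.mul_den_eq_num]
    exact_mod_cast h2.symm
  have hab : a ≤ b := by
    have : (a : ℚ) ≤ b := by
      rw [← ha]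
      nlinarith
    exact_mod_cast this
  obtain ⟨T, -, hT⟩ := Finset.exists_subset_card_eq
    (s := (Finset.univ : Finset (ZMod b))) (n := a) (by simpa [ZMod.card] using hab)
  have hTc : Tᶜ.card = b - a := by rw [Finset.card_compl, hT, ZMod.card]
  have hshift : ∀ (X : Finset (ZMod b)) (c : ZMod b), (X.image (· - c)).card = X.card := fun X c =>
    Finset.card_image_of_injective _ (sub_left_injective)
  have hmem : ∀ (X : Finset (ZMod b)) (c z : ZMod b), z ∈ X.image (· - c) ↔ z + c ∈ X := by
    intro X c z
    simp only [Finset.mem_image]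
    constructor
    · rintro ⟨y, hy, rfl⟩; simpa using hy
    · intro h; exact ⟨z + c, h, by simp⟩
  set Nv : Finset V := l.toFinset.filter (fun u => G.Adj v u) with hNv
  have hmemN : ∀ u, u ∈ Nv ↔ u ∈ l ∧ G.Adj v u := by simp [hNv]
  set Δ : V → (V → C × ZMod b) → Finset (C × ZMod b) := fun u φ =>
    if u = v then Finset.univ ×ˢ T.image (· - ∑ x ∈ Nv, (φ x).2)
    else Γ u (fun x => (φ x).1) ×ˢ
      if u ∈ Nv then Tᶜ.image (· - ((φ v).2 + ∑ x ∈ Nv.erase u, (φ x).2)) else Finset.univ with hΔ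
  refine ⟨C × ZMod b, inferInstance, inferInstance, Δ, ?_, ?_, ?_⟩
  · intro u hu φ ψ hφψ
    by_cases huv : u = v
    · subst huv
      simp only [hΔ, if_true]
      rw [Finset.sum_congr rfl fun x hx => by rw [hφψ x ((hmemN x).1 hx).2]]
    · have hul : u ∈ l := (List.mem_cons.1 hu).resolve_left huv
      simp only [hΔ, huv, if_false]
      rw [hloc u hul (fun x => (φ x).1) (fun x => (ψ x).1) fun x hx => by rw [hφψ x hx]]
      by_cases huN : u ∈ Nv
      · have huv' := ((hmemN u).1 huN).2
        rw [if_pos huN, if_pos huN, hφψ v huv'.symm,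
          Finset.sum_congr rfl fun x hx => by
            rw [hφψ x (hl.2.1 u hul x ((hmemN x).1 (Finset.mem_of_mem_erase hx)).1 huv'
              ((hmemN x).1 (Finset.mem_of_mem_erase hx)).2 (Finset.ne_of_mem_erase hx).symm)]]
      · rw [if_neg huN, if_neg huN]
  · intro u hu φ
    rw [Fintype.card_prod, ZMod.card]
    by_cases huv : u = v
    · subst huv
      simp only [hΔ, if_true]
      rw [Finset.card_product, hshift, hT, Finset.card_univ]
      push_cast
      rw [← ha]
      linarith
    · have hul : u ∈ l := (List.mem_cons.1 hu).resolve_left huv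
      simp only [hΔ, huv, if_false]
      rw [Finset.card_product]
      have hc := hcard u hul (fun x => (φ x).1)
      by_cases huN : u ∈ Nv
      · rw [if_pos huN, hshift, hTc]
        have hre : reweight G v w u = w u / (1 - w v) := by
          simp [reweight, ((hmemN u).1 huN).2]
        rw [hre] at hc
        have hba : ((b - a : ℕ) : ℚ) = (1 - w v) * b := by
          rw [Nat.cast_sub hab, ← ha]; ring
        have h1v : (1 - w v) ≠ 0 := by linarith
        push_cast
        rw [hba]
        calc ((Γ u fun x => (φ x).1).card : ℚ) * ((1 - w v) * b)
            ≤ (w u / (1 - w v) * Fintype.card C) * ((1 - w v) * b) :=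
              mul_le_mul_of_nonneg_right hc (mul_nonneg (by linarith) hb'.le)
          _ = _ := by field_simp
      · have hre : reweight G v w u = w u := by
          have : ¬ G.Adj v u := fun h => huN ((hmemN u).2 ⟨hul, h⟩)
          simp [reweight, this]
        rw [hre] at hc
        rw [if_neg huN, Finset.card_univ, ZMod.card]
        push_cast
        rw [← mul_assoc]
        exact mul_le_mul_of_nonneg_right hc hb'.le
  · intro φ
    by_cases hvT : (φ v).2 + ∑ x ∈ Nv, (φ x).2 ∈ T
    · refine ⟨v, by simp, ?_⟩
      simp only [hΔ, if_true, Finset.mem_product, Finset.mem_univ, true_and]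
      rwa [hmem]
    · obtain ⟨u, hul, hu⟩ := hwin fun x => (φ x).1
      have huv : u ≠ v := fun h => hl.1 (h ▸ hul)
      refine ⟨u, by simp [hul], ?_⟩
      simp only [hΔ, huv, if_false, Finset.mem_product]
      refine ⟨hu, ?_⟩
      by_cases huN : u ∈ Nv
      · rw [if_pos huN, hmem, Finset.mem_compl]
        rw [← Finset.add_sum_erase _ _ huN] at hvT
        convert hvT using 2
        ring
      · rw [if_neg huN]; exact Finset.mem_univ _

theorem IsElimOrder.winsOn {l : List V} (hl : IsElimOrder G l) {w : V → ℚ} (hw : ∀ u, 0 ≤ w u)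
    (hf : ¬ Feasible G l w) : WinsOn G l w := by
  induction l generalizing w with
  | nil => exact absurd trivial hf
  | cons v l ih =>
    by_cases hv : w v < 1
    · exact winsOn_cons hl hw hv
        (ih hl.2.2 (reweight_nonneg hw hv) fun h => hf ⟨hv, h⟩)
    · exact winsOn_cons_of_one_le hw (not_lt.1 hv)

/-- Taking `h₀` copies of every color makes the number of colors a multiple of `h₀`; guess sets are
then enlarged to the exact size. -/
theorem WinsOn.isWinningGame {l : List V} {h₀ g₀ : ℕ} (hh : 0 < h₀) (hgh : g₀ ≤ h₀)
    (hall : ∀ v, v ∈ l) (hwin : WinsOn G l fun _ => (g₀ : ℚ) / h₀) :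
    ∃ c, 0 < c ∧ IsWinningGame G (c * h₀) (c * g₀) := by
  classical
  obtain ⟨C, _, _, Γ, hloc, hcard, hwin⟩ := hwin
  refine ⟨Fintype.card C, Fintype.card_pos, ?_⟩
  have hcd : Fintype.card (C × Fin h₀) = Fintype.card C * h₀ := by simp
  let e : C × Fin h₀ ≃ Fin (Fintype.card C * h₀) := Fintype.equivFinOfCardEq hcd
  have : Nonempty (Fin h₀) := ⟨⟨0, hh⟩⟩
  let d : C × Fin h₀ := Classical.arbitrary _
  let ext : (v : V) → (G.neighborSet v → Fin (Fintype.card C * h₀)) → V → C := fun v φ u =>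
    -- The default color at vertices that `v` does not see is irrelevant, because `Γ` is local.
    if hu : G.Adj v u then (e.symm (φ ⟨u, hu⟩)).1 else d.1
  have hsup : ∀ v φ, ∃ A : Finset (Fin (Fintype.card C * h₀)),
      (Γ v (ext v φ) ×ˢ Finset.univ).map e.toEmbedding ⊆ A ∧ A.card = Fintype.card C * g₀ := by
    intro v φ
    have hle : ((Γ v (ext v φ) ×ˢ (Finset.univ : Finset (Fin h₀))).map e.toEmbedding).card ≤
        Fintype.card C * g₀ := by
      rw [Finset.card_map, Finset.card_product, Finset.card_fin]
      have h1 := hcard v (hall v) (ext v φ)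
      have hh' : (0 : ℚ) < h₀ := by exact_mod_cast hh
      rw [div_mul_eq_mul_div, le_div_iff₀ hh'] at h1
      have h2 : (Γ v (ext v φ)).card * h₀ ≤ g₀ * Fintype.card C := by exact_mod_cast h1
      linarith
    obtain ⟨A, hA, hA'⟩ := Finset.exists_superset_card_eq hle
      (by rw [Fintype.card_fin]; exact Nat.mul_le_mul_left _ hgh)
    exact ⟨A, hA, hA'⟩
  choose A hA hA' using hsup
  refine ⟨fun v φ => ⟨A v φ, hA' v φ⟩, fun φ => ?_⟩
  obtain ⟨v, -, hv⟩ := hwin fun u => (e.symm (φ u)).1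
  refine ⟨v, hA v _ ?_⟩
  rw [Finset.mem_map]
  refine ⟨e.symm (φ v), ?_, by simp⟩
  rw [Finset.mem_product]
  refine ⟨?_, Finset.mem_univ _⟩
  rw [hloc v (hall v) (ext v fun u => φ u) (fun u => (e.symm (φ u)).1)
    fun u hu => by simp [ext, hu]]
  exact hv

end Winning

/-! ### The fractional hat chromatic number of a graph with an elimination order -/

section FracHat

variable {V : Type*} {G : SimpleGraph V}

/-- The weights during the elimination are continuous in `x` as long as the divisors are nonzero. A
general family `w` lets the induction pass to the reweighted one. -/
theorem eventually_feasible {l : List V} (w : ℚ → V → ℚ) {x₀ : ℚ}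
    (hc : ∀ u, ContinuousAt (fun x => w x u) x₀) (hf : Feasible G l (w x₀)) :
    ∀ᶠ x in nhds x₀, Feasible G l (w x) := by
  induction l generalizing w with
  | nil => exact Filter.Eventually.of_forall fun _ => trivial
  | cons v l ih =>
    have h1 : ∀ᶠ x in nhds x₀, w x v < 1 := (hc v).eventually_lt continuousAt_const hf.1
    have h2 := ih (fun x => reweight G v (w x)) (fun u => ?_) hf.2
    · filter_upwards [h1, h2] with x hx1 hx2 using ⟨hx1, hx2⟩
    · unfold reweight
      split_ifs
      · exact (hc u).div (continuousAt_const.sub (hc v)) (by linarith [hf.1])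
      · exact hc u

theorem isWinningGame_one_one [Nonempty V] (G : SimpleGraph V) : IsWinningGame G 1 1 :=
  ⟨fun _ _ => ⟨Finset.univ, by simp⟩, fun _ => ⟨Classical.arbitrary V, Finset.mem_univ _⟩⟩

theorem fracHatNumber_le [Nonempty V] {B : ℝ}
    (hB : ∀ h g : ℕ, 0 < h → 0 < g → IsWinningGame G h g → (h : ℝ) / g ≤ B) :
    fracHatNumber G ≤ B := by
  refine csSup_le ⟨_, 1, 1, one_pos, one_pos, isWinningGame_one_one G, rfl⟩ ?_
  rintro x ⟨h, g, hh, hg, hwin, rfl⟩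
  exact hB h g hh hg hwin

variable [Fintype V]

theorem IsWinningGame.div_le_card {h g : ℕ} (hwin : IsWinningGame G h g) (hh : 0 < h)
    (hg : 0 < g) : (h : ℝ) / g ≤ Fintype.card V := by
  rw [div_le_iff₀ (by exact_mod_cast hg)]
  exact_mod_cast hwin.le_card_mul hh

theorem bddAbove_ratios (G : SimpleGraph V) :
    BddAbove {x : ℝ | ∃ h g : ℕ, 0 < h ∧ 0 < g ∧ IsWinningGame G h g ∧ x = (h : ℝ) / g} := by
  refine ⟨Fintype.card V, ?_⟩
  rintro x ⟨h, g, hh, hg, hwin, rfl⟩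
  exact hwin.div_le_card hh hg

theorem IsWinningGame.le_fracHatNumber {h g : ℕ} (hwin : IsWinningGame G h g) (hh : 0 < h)
    (hg : 0 < g) : (h : ℝ) / g ≤ fracHatNumber G :=
  le_csSup (bddAbove_ratios G) ⟨h, g, hh, hg, hwin, rfl⟩

theorem one_le_fracHatNumber [Nonempty V] (G : SimpleGraph V) : 1 ≤ fracHatNumber G := by
  simpa using (isWinningGame_one_one G).le_fracHatNumber one_pos one_pos

theorem fracHatNumber_le_card [Nonempty V] (G : SimpleGraph V) :
    fracHatNumber G ≤ Fintype.card V :=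
  fracHatNumber_le fun _ _ hh hg hwin => hwin.div_le_card hh hg

variable [Nonempty V] {l : List V}

/-- Feasibility persists at some `x > 1 / y`. Every winning game then has ratio at most `1 / x`,
which makes the inequality strict. -/
theorem IsElimOrder.fracHatNumber_lt (hl : IsElimOrder G l) (hall : ∀ v, v ∈ l) {y : ℚ}
    (hy : 0 < y) (hf : Feasible G l fun _ => 1 / y) : fracHatNumber G < y := by
  have hev := eventually_feasible (G := G) (l := l) (fun x _ => x) (fun _ => continuousAt_id) hf
  obtain ⟨x, hxf, hx⟩ := ((hev.filter_mono nhdsWithin_le_nhds).and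
    (self_mem_nhdsWithin : Set.Ioi (1 / y) ∈ nhdsWithin (1 / y) (Set.Ioi (1 / y)))).exists
  have hx : 1 / y < x := hx
  have hx0 : 0 < x := lt_trans (by positivity) hx
  have hle : fracHatNumber G ≤ ((1 / x : ℚ) : ℝ) := by
    refine fracHatNumber_le fun h g hh hg hwin => ?_
    by_contra hcon
    push Not at hcon
    refine hl.not_isWinningGame hall hx0.le hxf hh ?_ hwin
    have hh' : (0 : ℚ) < h := by exact_mod_cast hh
    have hg' : (0 : ℚ) < g := by exact_mod_cast hg
    have hcon' : 1 / x < (h : ℚ) / g := by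
      rw [← Rat.cast_lt (K := ℝ)]
      push_cast at hcon ⊢
      exact hcon
    rw [div_lt_div_iff₀ hx0 hg'] at hcon'
    rw [div_le_iff₀ hh']
    linarith
  refine hle.trans_lt ?_
  have : 1 / x < y := by
    rw [div_lt_iff₀ hx0]
    rw [div_lt_iff₀ hy] at hx
    linarith
  exact_mod_cast this

theorem IsElimOrder.le_fracHatNumber (hl : IsElimOrder G l) (hall : ∀ v, v ∈ l) {y : ℚ}
    (hy : 0 < y) (hf : ¬ Feasible G l fun _ => 1 / y) : (y : ℝ) ≤ fracHatNumber G := by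
  -- For `y ≥ 1` the numerator of `y` can serve as number of colors and the denominator as number of
  -- guesses; smaller `y` need no strategy.
  rcases le_total y 1 with hy1 | hy1
  · exact le_trans (by exact_mod_cast hy1) (one_le_fracHatNumber G)
  have hnum : ((y.num.toNat : ℕ) : ℤ) = y.num := Int.toNat_of_nonneg (Rat.num_nonneg.2 hy.le)
  have hnumq : ((y.num.toNat : ℕ) : ℚ) = y.num := by
    exact_mod_cast congrArg (Int.cast (R := ℚ)) hnum
  have hden : (0 : ℚ) < y.den := by exact_mod_cast y.den_pos
  have hyq : y = (y.num.toNat : ℚ) / y.den := by rw [hnumq, Rat.num_div_den]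
  have hpos : 0 < y.num.toNat := by
    have : 0 < y.num := Rat.num_pos.2 hy
    omega
  have hle : y.den ≤ y.num.toNat := by
    rw [hyq, le_div_iff₀ hden] at hy1
    have : (y.den : ℚ) ≤ y.num.toNat := by linarith
    exact_mod_cast this
  have hinv : 1 / y = (y.den : ℚ) / (y.num.toNat : ℕ) := by
    conv_lhs => rw [hyq]
    rw [one_div_div]
  obtain ⟨c, hc, hwin⟩ := (hinv ▸ hl.winsOn (fun _ => by positivity) hf).isWinningGame
    hpos hle hall
  have := hwin.le_fracHatNumber (Nat.mul_pos hc hpos) (Nat.mul_pos hc y.den_pos)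
  refine le_trans (le_of_eq ?_) this
  have hc' : (c : ℚ) ≠ 0 := by exact_mod_cast hc.ne'
  have : y = ((c * y.num.toNat : ℕ) : ℚ) / ((c * y.den : ℕ) : ℚ) := by
    push_cast
    rw [mul_div_mul_left _ _ hc', ← hyq]
  have := congrArg (Rat.cast (K := ℝ)) this
  push_cast at this ⊢
  exact this

theorem IsElimOrder.le_fracHatNumber_iff (hl : IsElimOrder G l) (hall : ∀ v, v ∈ l) {y : ℚ}
    (hy : 0 < y) : (y : ℝ) ≤ fracHatNumber G ↔ ¬ Feasible G l fun _ => 1 / y :=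
  ⟨fun h hf => absurd h (not_le.2 (hl.fracHatNumber_lt hall hy hf)), hl.le_fracHatNumber hall hy⟩

/-- A rational fractional hat chromatic number is an integer. -/
theorem IsElimOrder.fracHatNumber_eq_natCast (hl : IsElimOrder G l) (hall : ∀ v, v ∈ l) {r : ℚ}
    (hr : fracHatNumber G = r) : ∃ m : ℕ, fracHatNumber G = m := by
  have hr1 : 1 ≤ r := by
    have := one_le_fracHatNumber G
    rw [hr] at this
    exact_mod_cast this
  have hr0 : 0 < r := by linarith
  have hnf := (hl.le_fracHatNumber_iff hall hr0).1 hr.ge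
  obtain ⟨l', hl', hle⟩ := hl.exists_initial_indepVal_nonpos hnf
  obtain ⟨P, hP0, hP⟩ := exists_polynomial_indepVal G l'
  rw [hP] at hle
  -- Weights below `1 / r` are feasible, so the polynomial is positive there and nonnegative in the
  -- limit.
  have hge : 0 ≤ Polynomial.aeval (1 / r) P := by
    have hcont : Continuous fun x : ℚ => Polynomial.aeval x P := P.continuous_aeval
    refine ge_of_tendsto ((hcont.tendsto (1 / r)).mono_left
      (nhdsWithin_le_nhds (s := Set.Iio (1 / r)))) ?_
    have hpos : Set.Ioo 0 (1 / r) ∈ nhdsWithin (1 / r) (Set.Iio (1 / r)) :=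
      Ioo_mem_nhdsLT (by positivity)
    filter_upwards [hpos] with x hx
    rw [← hP]
    refine (IsElimOrder.indepVal_pos (hl.sublist hl'.sublist) ?_).le
    obtain ⟨l'', rfl⟩ := hl'
    have hfx : Feasible G (l' ++ l'') fun _ => 1 / (1 / x) := by
      by_contra hcon
      have h1 := (hl.le_fracHatNumber_iff hall (y := 1 / x) (one_div_pos.2 hx.1)).2 hcon
      rw [hr] at h1
      have h1 : 1 / x ≤ r := by exact_mod_cast h1
      have h2 := hx.2
      rw [lt_div_iff₀ hr0] at h2
      rw [div_le_iff₀ hx.1] at h1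
      linarith
    rw [one_div_one_div] at hfx
    exact ((feasible_append _ _ _).1 hfx).1
  have h0 : Polynomial.aeval (1 / r) P = 0 := le_antisymm hle hge
  -- Reversal turns the constant coefficient `1` into the leading one and the root `1 / r` into `r`.
  have hmonic : P.reverse.Monic := by
    have hne : P.coeff 0 ≠ 0 := by rw [hP0]; exact one_ne_zero
    rw [Polynomial.Monic, Polynomial.reverse_leadingCoeff, Polynomial.trailingCoeff,
      Polynomial.natTrailingDegree_eq_zero.2 (.inr hne), hP0]
  have hroot : Polynomial.aeval r P.reverse = 0 := by
    have h0' : Polynomial.eval₂ (algebraMap ℤ ℚ) (1 / r) P = 0 := h0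
    have : Invertible (1 / r) := invertibleOfNonzero (by positivity)
    rw [← Polynomial.eval₂_reverse_eq_zero_iff, invOf_eq_inv, one_div, inv_inv] at h0'
    exact h0'
  obtain ⟨z, hz⟩ := isInteger_of_is_root_of_monic hmonic hroot
  have hz' : (z : ℚ) = r := by simpa using hz
  have hz0 : 0 ≤ z := by
    have : (0 : ℚ) ≤ z := by rw [hz']; exact hr0.le
    exact_mod_cast this
  refine ⟨z.toNat, ?_⟩
  rw [hr, ← hz']
  have : ((z.toNat : ℕ) : ℤ) = z := Int.toNat_of_nonneg hz0
  exact_mod_cast congrArg (Int.cast (R := ℝ)) this.symm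

end FracHat

/-! ### Reasoning about programs -/

section Machine

@[simp]
theorem State.reg_setReg (s : State) (x r : ℕ) (q : ℚ) :
    (s.setReg x q).reg r = if r = x then q else s.reg r := by
  simp [State.setReg, Function.update_apply]

@[simp]
theorem State.arr_setReg (s : State) (x : ℕ) (q : ℚ) : (s.setReg x q).arr = s.arr := rfl

@[simp]
theorem State.reg_setArr (s : State) (a i : ℕ) (q : ℚ) : (s.setArr a i q).reg = s.reg := rfl

theorem State.arr_setArr (s : State) (a i a' j : ℕ) (q : ℚ) :
    (s.setArr a i q).arr a' j = if a' = a ∧ j = i then q else s.arr a' j := by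
  by_cases h : a' = a
  · subst h
    simp [State.setArr, Function.update_apply]
  · simp [State.setArr, h]

/-- Does the program write into register `r`? -/
def Prog.writesReg : Prog → ℕ → Bool
  | .skip, _ => false
  | .const x _, r => r == x
  | .arith _ x _ _, r => r == x
  | .load x _ _, r => r == x
  | .store _ _ _, _ => false
  | .seq P Q, r => P.writesReg r || Q.writesReg r
  | .ite _ _ P Q, r => P.writesReg r || Q.writesReg r
  | .loop _ _ P, r => P.writesReg r

/-- Does the program write into the array `a`? -/
def Prog.writesArr : Prog → ℕ → Bool
  | .skip, _ => false
  | .const _ _, _ => false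
  | .arith _ _ _ _, _ => false
  | .load _ _ _, _ => false
  | .store a _ _, a' => a' == a
  | .seq P Q, a => P.writesArr a || Q.writesArr a
  | .ite _ _ P Q, a => P.writesArr a || Q.writesArr a
  | .loop _ _ P, a => P.writesArr a

/-- The states `s` and `s'` agree on all that `P` does not write. -/
structure Frame (P : Prog) (s s' : State) : Prop where
  reg : ∀ r, P.writesReg r = false → s'.reg r = s.reg r
  arr : ∀ a, P.writesArr a = false → s'.arr a = s.arr a

theorem Frame.refl (P : Prog) (s : State) : Frame P s s := ⟨fun _ _ => rfl, fun _ _ => rfl⟩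

theorem Frame.trans {P : Prog} {s s' s'' : State} (h : Frame P s s') (h' : Frame P s' s'') :
    Frame P s s'' :=
  ⟨fun r hr => (h'.reg r hr).trans (h.reg r hr), fun a ha => (h'.arr a ha).trans (h.arr a ha)⟩

/-- What a program leaves alone can be read off from its text, so such facts are settled by `rfl` or
`decide`. -/
theorem Run.frame {b : ℕ} {P : Prog} {s s' : State} {t : ℕ} (h : Run b P s t s') :
    Frame P s s' := by
  induction h with
  | skip s => exact Frame.refl _ _
  | const x q s hb =>
    exact ⟨fun r hr => by simp_all [Prog.writesReg], fun a _ => rfl⟩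
  | arith o x y z s hb =>
    exact ⟨fun r hr => by simp_all [Prog.writesReg], fun a _ => rfl⟩
  | load x a i s hb =>
    exact ⟨fun r hr => by simp_all [Prog.writesReg], fun a _ => rfl⟩
  | store a i x s hb =>
    refine ⟨fun r _ => rfl, fun a' ha => ?_⟩
    have : a' ≠ a := by simpa [Prog.writesArr] using ha
    funext j
    simp [State.arr_setArr, this]
  | seq _ _ ih ih' =>
    refine ⟨fun r hr => ?_, fun a ha => ?_⟩
    · simp only [Prog.writesReg, Bool.or_eq_false_iff] at hr
      rw [ih'.reg r hr.2, ih.reg r hr.1]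
    · simp only [Prog.writesArr, Bool.or_eq_false_iff] at ha
      rw [ih'.arr a ha.2, ih.arr a ha.1]
  | ite_true _ _ ih =>
    refine ⟨fun r hr => ?_, fun a ha => ?_⟩
    · simp only [Prog.writesReg, Bool.or_eq_false_iff] at hr
      exact ih.reg r hr.1
    · simp only [Prog.writesArr, Bool.or_eq_false_iff] at ha
      exact ih.arr a ha.1
  | ite_false _ _ ih =>
    refine ⟨fun r hr => ?_, fun a ha => ?_⟩
    · simp only [Prog.writesReg, Bool.or_eq_false_iff] at hr
      exact ih.reg r hr.2
    · simp only [Prog.writesArr, Bool.or_eq_false_iff] at ha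
      exact ih.arr a ha.2
  | loop_false _ => exact Frame.refl _ _
  | loop_true _ _ _ ih ih' =>
    exact ⟨fun r hr => (ih'.reg r hr).trans (ih.reg r hr),
      fun a ha => (ih'.arr a ha).trans (ih.arr a ha)⟩

/-- `Halts b T P s Q`: started in `s`, the program halts within `T` steps in a state with the
property `Q`, and writes only numbers of bit length at most `b`. -/
def Halts (b T : ℕ) (P : Prog) (s : State) (Q : State → Prop) : Prop :=
  ∃ t s', Run b P s t s' ∧ t ≤ T ∧ Q s'

variable {b T : ℕ} {P P' : Prog} {s : State} {Q : State → Prop}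

theorem Halts.mono {T' : ℕ} {Q' : State → Prop} (h : Halts b T P s Q) (hT : T ≤ T')
    (hQ : ∀ s', Q s' → Frame P s s' → Q' s') : Halts b T' P s Q' := by
  obtain ⟨t, s', hr, ht, hq⟩ := h
  exact ⟨t, s', hr, ht.trans hT, hQ s' hq hr.frame⟩

theorem Halts.seq {T' : ℕ} (h : Halts b T P s fun s' => Halts b T' P' s' Q) :
    Halts b (T + T') (.seq P P') s Q := by
  obtain ⟨t, s', hr, ht, t', s'', hr', ht', hq⟩ := h
  exact ⟨t + t', s'', hr.seq hr', by omega, hq⟩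

/-- `N` rounds of a loop that is controlled by the counter `i` and the bound in register `m`;
register `2` holds the number one. -/
theorem Halts.count {i m N : ℕ} {s₀ : State} (Inv : ℕ → State → Prop)
    (hwi : P.writesReg i = false) (hwm : P.writesReg m = false) (hwo : P.writesReg 2 = false)
    (him : i ≠ m) (hio : i ≠ 2) (hbit : ∀ j ≤ N, bitLength (j : ℚ) ≤ b)
    (hm : s₀.reg m = N) (ho : s₀.reg 2 = 1) (hi : s₀.reg i = 0)
    (hirr : ∀ j s q, Inv j s → Inv j (s.setReg i q)) (h0 : Inv 0 s₀)
    (hstep : ∀ j < N, ∀ s, Inv j s → s.reg i = j →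
      Frame (.loop i m (.seq P (.arith .add i i 2))) s₀ s → Halts b T P s (Inv (j + 1))) :
    Halts b (N * (T + 2) + 1) (.loop i m (.seq P (.arith .add i i 2))) s₀ (Inv N) := by
  set L := Prog.loop i m (.seq P (.arith .add i i 2)) with hL
  have hLm : L.writesReg m = false := by simp [hL, Prog.writesReg, hwm, him.symm]
  have hLo : L.writesReg 2 = false := by simp [hL, Prog.writesReg, hwo, hio.symm]
  -- Induction on the number `d` of remaining rounds; the frame from `s₀` keeps the bound and the
  -- constant one available.
  suffices key : ∀ d j, j + d = N → ∀ s, Inv j s → s.reg i = j → Frame L s₀ s →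
      Halts b (d * (T + 2) + 1) L s (Inv N) by
    exact key N 0 (by omega) s₀ h0 (by simpa using hi) (Frame.refl _ _)
  intro d
  induction d with
  | zero =>
    intro j hj s hs hsi hf
    obtain rfl : j = N := by omega
    refine ⟨1, s, Run.loop_false ?_, by omega, hs⟩
    rw [hsi, hf.reg m hLm, hm]
    exact lt_irrefl _
  | succ d ih =>
    intro j hj s hs hsi hf
    have hjN : j < N := by omega
    obtain ⟨t, s', hr, ht, hq⟩ := hstep j hjN s hs hsi hf
    have hi' : s'.reg i = j := (hr.frame.reg i hwi).trans hsi
    have ho' : s'.reg 2 = 1 := by rw [hr.frame.reg 2 hwo, hf.reg 2 hLo, ho]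
    have hval : Op.add.eval (s'.reg i) (s'.reg 2) = ((j + 1 : ℕ) : ℚ) := by
      rw [hi', ho']; simp [Op.eval]
    have hinc : Run b (.arith .add i i 2) s' 1 (s'.setReg i ((j + 1 : ℕ) : ℚ)) := by
      have := Run.arith (b := b) .add i i 2 s' (by rw [hval]; exact hbit _ hjN)
      rwa [hval] at this
    have hbody := hr.seq hinc
    have hf' : Frame L s (s'.setReg i ((j + 1 : ℕ) : ℚ)) :=
      ⟨hbody.frame.reg, hbody.frame.arr⟩
    obtain ⟨t', s'', hr', ht', hq'⟩ := ih (j + 1) (by omega) _ (hirr _ _ _ hq) (by simp)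
      (hf.trans hf')
    have hlt : s.reg i < s.reg m := by
      rw [hsi, hf.reg m hLm, hm]
      exact_mod_cast hjN
    refine ⟨_, s'', Run.loop_true hlt hbody hr', ?_, hq'⟩
    rw [Nat.succ_mul]
    omega

/-- A bound on the number of steps of a program whose loops have at most `X` rounds. -/
noncomputable def Prog.cost : Prog → Polynomial ℕ
  | .skip => 1
  | .const _ _ => 1
  | .arith _ _ _ _ => 1
  | .load _ _ _ => 1
  | .store _ _ _ => 1
  | .seq P Q => P.cost + Q.cost
  | .ite _ _ P Q => P.cost + Q.cost + 1
  | .loop _ _ P => Polynomial.X * (P.cost + 1) + 1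

/-- The program halts within its cost at `n`. -/
def Does (b n : ℕ) (P : Prog) (s : State) (Q : State → Prop) : Prop :=
  Halts b (P.cost.eval n) P s Q

variable {n : ℕ}

theorem Does.mono {Q' : State → Prop} (h : Does b n P s Q)
    (hQ : ∀ s', Q s' → Frame P s s' → Q' s') : Does b n P s Q' :=
  Halts.mono h le_rfl hQ

theorem Does.skip (h : Q s) : Does b n .skip s Q :=
  ⟨1, s, Run.skip s, by simp [Prog.cost], h⟩

theorem Does.const {x : ℕ} {q : ℚ} (hb : bitLength q ≤ b) (h : Q (s.setReg x q)) :
    Does b n (.const x q) s Q :=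
  ⟨1, _, Run.const x q s hb, by simp [Prog.cost], h⟩

theorem Does.arith {o : Op} {x y z : ℕ} (q : ℚ) (hq : o.eval (s.reg y) (s.reg z) = q)
    (hb : bitLength q ≤ b) (h : Q (s.setReg x q)) : Does b n (.arith o x y z) s Q := by
  subst hq
  exact ⟨1, _, Run.arith o x y z s hb, by simp [Prog.cost], h⟩

theorem Does.load {x a i : ℕ} (j : ℕ) (q : ℚ) (hj : s.reg i = j) (hq : s.arr a j = q)
    (hb : bitLength q ≤ b) (h : Q (s.setReg x q)) : Does b n (.load x a i) s Q := by
  have hfl : ⌊s.reg i⌋₊ = j := by rw [hj, Nat.floor_natCast]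
  subst hq
  have := Run.load (b := b) x a i s (by rwa [hfl])
  rw [hfl] at this
  exact ⟨1, _, this, by simp [Prog.cost], h⟩

theorem Does.store {a i x : ℕ} (j : ℕ) (q : ℚ) (hj : s.reg i = j) (hq : s.reg x = q)
    (hb : bitLength q ≤ b) (h : Q (s.setArr a j q)) : Does b n (.store a i x) s Q := by
  have hfl : ⌊s.reg i⌋₊ = j := by rw [hj, Nat.floor_natCast]
  subst hq
  have := Run.store (b := b) a i x s hb
  rw [hfl] at this
  exact ⟨1, _, this, by simp [Prog.cost], h⟩

theorem Does.seq (h : Does b n P s fun s' => Does b n P' s' Q) : Does b n (.seq P P') s Q := by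
  have := Halts.seq h
  simpa [Does, Prog.cost] using this

theorem Does.ite {x y : ℕ} (ht : s.reg x < s.reg y → Does b n P s Q)
    (hf : ¬ s.reg x < s.reg y → Does b n P' s Q) : Does b n (.ite x y P P') s Q := by
  by_cases h : s.reg x < s.reg y
  · obtain ⟨t, s', hr, ht, hq⟩ := ht h
    exact ⟨t + 1, s', hr.ite_true h, by simp [Prog.cost]; omega, hq⟩
  · obtain ⟨t, s', hr, ht, hq⟩ := hf h
    exact ⟨t + 1, s', hr.ite_false h, by simp [Prog.cost]; omega, hq⟩

/-- `for i = 0, …, n - 1 do P`; register `0` holds `n`, register `2` holds one. -/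
def Prog.forAll (i : ℕ) (P : Prog) : Prog :=
  .seq (.const i 0) (.loop i 0 (.seq P (.arith .add i i 2)))

/-- The hypothesis `hirr` makes the invariant independent of the counter, so that it survives the
increment after the body. -/
theorem Does.forAll {i : ℕ} (Inv : ℕ → State → Prop)
    (hst : P.writesReg i = false ∧ P.writesReg 0 = false ∧ P.writesReg 2 = false ∧ i ≠ 0 ∧ i ≠ 2)
    (hbit : ∀ j ≤ n, bitLength (j : ℚ) ≤ b) (hn : s.reg 0 = n) (ho : s.reg 2 = 1)
    (hirr : ∀ j s q, Inv j s → Inv j (s.setReg i q)) (h0 : Inv 0 s)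
    (hstep : ∀ j < n, ∀ s', Inv j s' → s'.reg i = j → Frame (Prog.forAll i P) s s' →
      Does b n P s' (Inv (j + 1)))
    (hQ : ∀ s', Inv n s' → Frame (Prog.forAll i P) s s' → Q s') :
    Does b n (Prog.forAll i P) s Q := by
  obtain ⟨hwi, hw0, hw2, hi0, hi2⟩ := hst
  refine Does.mono (Q := Inv n) ?_ hQ
  refine Does.seq (Does.const (by simpa using hbit 0 (Nat.zero_le _)) ?_)
  have := Halts.count (s₀ := s.setReg i 0) (T := P.cost.eval n) Inv hwi hw0 hw2 hi0 hi2 hbit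
    (by simpa [hi0.symm] using hn) (by simpa [hi2.symm] using ho) (by simp) hirr (hirr _ _ _ h0)
    (fun j hj s' hs' hi hf => hstep j hj s' hs' hi ⟨fun r hr => ?_, fun a ha => ?_⟩)
  · refine Halts.mono this ?_ fun s' h _ => h
    simp [Prog.cost]
    ring_nf
    exact le_rfl
  · simp only [Prog.forAll, Prog.writesReg, Bool.or_eq_false_iff] at hr
    rw [hf.reg r (by simpa [Prog.writesReg] using hr.2)]
    have : r ≠ i := by simpa using hr.1
    simp [this]
  · simp only [Prog.forAll, Prog.writesArr, Bool.or_eq_false_iff] at ha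
    rw [hf.arr a (by simpa [Prog.writesArr] using ha.2)]
    rfl

/-! ### Bit lengths -/

/-- In lowest terms, the denominator divides `D` and the numerator divides `N`. -/
theorem bitLength_div_le {N D : ℤ} (hD : D ≠ 0) {m : ℕ} (hN : N.natAbs < 2 ^ m)
    (hD' : D.natAbs < 2 ^ m) : bitLength ((N : ℚ) / D) ≤ 2 * m := by
  have h1 : ((N : ℚ) / D).num ∣ N := by
    rw [← Rat.divInt_eq_div]
    exact Rat.num_dvd N hD
  have h2 : ((((N : ℚ) / D).den : ℕ) : ℤ) ∣ D := by
    rw [← Rat.divInt_eq_div]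
    exact Rat.den_dvd N D
  have e2 : ((N : ℚ) / D).den < 2 ^ m := by
    refine lt_of_le_of_lt (Nat.le_of_dvd (Int.natAbs_pos.2 hD) ?_) hD'
    exact Int.natCast_dvd.1 h2
  have e1 : ((N : ℚ) / D).num.natAbs < 2 ^ m := by
    by_cases h0 : N = 0
    · subst h0; simp
    · exact lt_of_le_of_lt (Nat.le_of_dvd (Int.natAbs_pos.2 h0) (Int.natAbs_dvd_natAbs.2 h1)) hN
  unfold bitLength
  have f1 := Nat.size_le.2 e1
  have f2 := Nat.size_le.2 e2
  omega

theorem bitLength_natCast_le {m N : ℕ} (h : m ≤ N) : bitLength (m : ℚ) ≤ N + 1 := by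
  have : m.size ≤ N := Nat.size_le.2 (h.trans_lt Nat.lt_two_pow_self)
  simp [bitLength]
  omega

end Machine

/-! ### Computation of an elimination order

Register `0` holds `n`, register `2` holds one, register `3` holds zero. Array `0` is the adjacency
matrix, array `1` marks the eliminated vertices, and array `2` receives the order. -/

section OrderProgram

/-- `x := A[u, v]`, where `u` and `v` are registers. -/
def Prog.adj (x u v : ℕ) : Prog :=
  .seq (.arith .mul 11 0 u) (.seq (.arith .add 11 11 v) (.load x 0 11))

/-- Clear register `8` if the vertices in registers `6` and `7` show that the vertex in register
`5` is not simplicial. -/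
def Prog.checkPair : Prog :=
  .ite 6 7
    (.seq (.load 10 1 6) (.ite 10 2
      (.seq (.load 10 1 7) (.ite 10 2
        (.seq (.adj 10 5 6) (.ite 3 10
          (.seq (.adj 10 5 7) (.ite 3 10
            (.seq (.adj 10 6 7) (.ite 10 2 (.const 8 0) .skip))
            .skip))
          .skip))
        .skip))
      .skip))
    .skip

/-- Set register `8` to one or zero according to whether the vertex in register `5` is simplicial
among the vertices that are left. -/
def Prog.checkSimplicial : Prog :=
  .seq (.const 8 1) (.forAll 6 (.forAll 7 .checkPair))

/-- Put into register `9` a simplicial vertex among the vertices that are left. -/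
def Prog.findSimplicial : Prog :=
  .forAll 5 (.seq (.load 10 1 5) (.ite 10 2
    (.seq .checkSimplicial (.ite 3 8 (.arith .add 9 5 3) .skip)) .skip))

/-- Compute an elimination order. -/
def Prog.findOrder : Prog :=
  .forAll 4 (.seq .findSimplicial (.seq (.store 2 4 9) (.store 1 9 2)))

variable {n b : ℕ} {G : SimpleGraph (Fin n)} {s : State}

open Classical in
/-- The part of the memory that stays fixed. -/
structure Holds (G : SimpleGraph (Fin n)) (s : State) : Prop where
  size : s.reg 0 = n
  one : s.reg 2 = 1
  zero : s.reg 3 = 0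
  adj : ∀ u v : Fin n, s.arr 0 (n * (u : ℕ) + (v : ℕ)) = if G.Adj u v then 1 else 0

theorem Holds.frame {P : Prog} {s' : State} (h : Holds G s) (hf : Frame P s s')
    (hP : P.writesReg 0 = false ∧ P.writesReg 2 = false ∧ P.writesReg 3 = false ∧
      P.writesArr 0 = false) : Holds G s' :=
  ⟨by rw [hf.reg 0 hP.1, h.size], by rw [hf.reg 2 hP.2.1, h.one],
    by rw [hf.reg 3 hP.2.2.1, h.zero], by rw [hf.arr 0 hP.2.2.2]; exact h.adj⟩

/-- All natural numbers up to `n * n + 1` may be written. -/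
def SmallOk (n b : ℕ) : Prop := ∀ m : ℕ, m ≤ n * n + 1 → bitLength (m : ℚ) ≤ b

theorem SmallOk.one (h : SmallOk n b) : bitLength 1 ≤ b := by simpa using h 1 (by omega)

theorem SmallOk.zero (h : SmallOk n b) : bitLength 0 ≤ b := by simpa using h 0 (by omega)

theorem SmallOk.index (h : SmallOk n b) : ∀ j ≤ n, bitLength (j : ℚ) ≤ b := fun j hj =>
  h j (by nlinarith)

theorem SmallOk.bit (h : SmallOk n b) (p : Prop) [Decidable p] :
    bitLength (if p then 1 else 0) ≤ b := by
  split_ifs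
  · exact h.one
  · exact h.zero

open Classical in
theorem does_adj (hs : Holds G s) (hb : SmallOk n b) {x ru rv : ℕ} (u v : Fin n)
    (hu : s.reg ru = (u : ℕ)) (hv : s.reg rv = (v : ℕ)) (hv11 : rv ≠ 11) :
    Does b n (Prog.adj x ru rv) s (fun s' => s'.reg x = if G.Adj u v then 1 else 0) := by
  have hun : n * (u : ℕ) ≤ n * n := Nat.mul_le_mul_left _ u.2.le
  have huv : n * (u : ℕ) + v < n * n := by
    have h1 : n * (u : ℕ) + n ≤ n * n := by
      have := Nat.mul_le_mul_left n u.2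
      rwa [Nat.mul_succ] at this
    omega
  refine Does.seq (Does.arith ((n * (u : ℕ) : ℕ) : ℚ) (by simp [Op.eval, hs.size, hu])
    (hb _ (by omega)) (Does.seq (Does.arith ((n * (u : ℕ) + (v : ℕ) : ℕ) : ℚ)
      (by simp [Op.eval, hv, hv11]) (hb _ (by omega)) ?_)))
  refine Does.load (n * (u : ℕ) + (v : ℕ)) (if G.Adj u v then 1 else 0) (by simp) ?_
    (hb.bit _) (by simp)
  simpa using hs.adj u v

/-- The vertices `u`, `w` outside of `D` show that `v` is not simplicial. -/
def BadPair (G : SimpleGraph (Fin n)) (D : List (Fin n)) (v u w : Fin n) : Prop :=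
  u < w ∧ u ∉ D ∧ w ∉ D ∧ G.Adj v u ∧ G.Adj v w ∧ ¬ G.Adj u w

open Classical in
theorem does_checkPair (hs : Holds G s) (hb : SmallOk n b) {D : List (Fin n)}
    (hD : ∀ v : Fin n, s.arr 1 v = if v ∈ D then 1 else 0) (v u w : Fin n)
    (hv : s.reg 5 = (v : ℕ)) (hu : s.reg 6 = (u : ℕ)) (hw : s.reg 7 = (w : ℕ)) :
    Does b n Prog.checkPair s
      (fun s' => s'.reg 8 = if BadPair G D v u w then 0 else s.reg 8) := by
  refine Does.ite (fun h => ?_) (fun h => Does.skip ?_)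
  swap
  · rw [hu, hw] at h
    have : ¬ u < w := fun h' => h (by exact_mod_cast h')
    simp [BadPair, this]
  have huw : u < w := by rw [hu, hw] at h; exact_mod_cast h
  refine Does.seq (Does.load u _ hu (hD u) (hb.bit _) (Does.ite (fun h => ?_)
    (fun h => Does.skip ?_)))
  swap
  · have : u ∈ D := by by_contra hc; simp [hc, hs.one] at h
    simp [BadPair, this]
  have huD : u ∉ D := by intro hc; simp [hc, hs.one] at h
  refine Does.seq (Does.load w _ (by simpa using hw) (hD w) (hb.bit _) (Does.ite (fun h => ?_)
    (fun h => Does.skip ?_)))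
  swap
  · have : w ∈ D := by by_contra hc; simp [hc, hs.one] at h
    simp [BadPair, this]
  have hwD : w ∉ D := by intro hc; simp [hc, hs.one] at h
  generalize hs₁ : State.setReg _ _ _ = s₁
  have e5 : s₁.reg 5 = (v : ℕ) := by simp [← hs₁, hv]
  have e6 : s₁.reg 6 = (u : ℕ) := by simp [← hs₁, hu]
  have e7 : s₁.reg 7 = (w : ℕ) := by simp [← hs₁, hw]
  have e8 : s₁.reg 8 = s.reg 8 := by simp [← hs₁]
  have H₁ : Holds G s₁ := ⟨by simp [← hs₁, hs.size], by simp [← hs₁, hs.one],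
    by simp [← hs₁, hs.zero], by simpa [← hs₁] using hs.adj⟩
  clear hs₁ h
  refine Does.seq ((does_adj H₁ hb v u e5 e6 (by decide)).mono fun s₂ h₂ f₂ => ?_)
  have H₂ := H₁.frame f₂ (by decide)
  refine Does.ite (fun h => ?_) (fun h => Does.skip ?_)
  swap
  · have : ¬ G.Adj v u := by intro hc; simp [h₂, hc, H₂.zero] at h
    simp [BadPair, this, f₂.reg 8 rfl, e8]
  have hvu : G.Adj v u := by by_contra hc; simp [h₂, hc, H₂.zero] at h
  refine Does.seq ((does_adj H₂ hb v w (by rw [f₂.reg 5 rfl, e5]) (by rw [f₂.reg 7 rfl, e7])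
    (by decide)).mono fun s₃ h₃ f₃ => ?_)
  have H₃ := H₂.frame f₃ (by decide)
  refine Does.ite (fun h => ?_) (fun h => Does.skip ?_)
  swap
  · have : ¬ G.Adj v w := by intro hc; simp [h₃, hc, H₃.zero] at h
    simp [BadPair, this, f₃.reg 8 rfl, f₂.reg 8 rfl, e8]
  have hvw : G.Adj v w := by by_contra hc; simp [h₃, hc, H₃.zero] at h
  refine Does.seq ((does_adj H₃ hb u w (by rw [f₃.reg 6 rfl, f₂.reg 6 rfl, e6])
    (by rw [f₃.reg 7 rfl, f₂.reg 7 rfl, e7]) (by decide)).mono fun s₄ h₄ f₄ => ?_)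
  have H₄ := H₃.frame f₄ (by decide)
  refine Does.ite (fun h => Does.const hb.zero ?_) (fun h => Does.skip ?_)
  · have : ¬ G.Adj u w := by intro hc; simp [h₄, hc, H₄.one] at h
    simp [BadPair, huw, huD, hwD, hvu, hvw, this]
  · have : G.Adj u w := by by_contra hc; simp [h₄, hc, H₄.one] at h
    simp [BadPair, this, f₄.reg 8 rfl, f₃.reg 8 rfl, f₂.reg 8 rfl, e8]

/-- Adjacency is symmetric, so testing pairs `u < w` is enough. -/
theorem isSimplicialIn_compl_iff {D : List (Fin n)} {v : Fin n} :
    IsSimplicialIn G {x | x ∉ D} v ↔ ∀ u w, ¬ BadPair G D v u w := by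
  constructor
  · rintro h u w ⟨huw, hu, hw, hvu, hvw, hna⟩
    exact hna (h u hu w hw hvu hvw huw.ne)
  · intro h u hu w hw hvu hvw hne
    by_contra hna
    rcases lt_or_gt_of_ne hne with hlt | hlt
    · exact h u w ⟨hlt, hu, hw, hvu, hvw, hna⟩
    · exact h w u ⟨hlt, hw, hu, hvw, hvu, fun h' => hna h'.symm⟩

open Classical in
theorem does_checkSimplicial (hs : Holds G s) (hb : SmallOk n b) {D : List (Fin n)}
    (hD : ∀ v : Fin n, s.arr 1 v = if v ∈ D then 1 else 0) (v : Fin n)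
    (hv : s.reg 5 = (v : ℕ)) :
    Does b n Prog.checkSimplicial s
      (fun s' => s'.reg 8 = if IsSimplicialIn G {x | x ∉ D} v then 1 else 0) := by
  refine Does.seq (Does.const hb.one ?_)
  refine Does.forAll (fun j s' => s'.reg 8 =
      if ∀ u w : Fin n, (u : ℕ) < j → ¬ BadPair G D v u w then 1 else 0)
    (by decide) hb.index (by simpa using hs.size) (by simpa using hs.one)
    (fun j s q h => by simpa using h) (by simp) (fun j hj s₁ h₁ hj₁ f₁ => ?_) (fun s₁ h₁ _ => ?_)
  swap
  · rw [h₁, isSimplicialIn_compl_iff]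
    simp
  have H₁ : Holds G s₁ := Holds.frame (s := s.setReg 8 1)
    ⟨by simpa using hs.size, by simpa using hs.one, by simpa using hs.zero, hs.adj⟩ f₁ (by decide)
  -- Pairs are scanned lexicographically: complete rows before `j`, then row `j` up to column `i`.
  refine Does.forAll (fun i s' => s'.reg 8 =
      if ∀ u w : Fin n, ((u : ℕ) < j ∨ (u : ℕ) = j ∧ (w : ℕ) < i) → ¬ BadPair G D v u w
      then 1 else 0)
    (by decide) hb.index H₁.size H₁.one
    (fun j s q h => by simpa using h) (by simpa using h₁) (fun i hi s₂ h₂ hi₂ f₂ => ?_)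
    (fun s₂ h₂ _ => ?_)
  swap
  · rw [h₂]
    congr 1
    refine propext (forall₂_congr fun u w => ?_)
    have : ((u : ℕ) < j ∨ (u : ℕ) = j ∧ (w : ℕ) < n) ↔ (u : ℕ) < j + 1 := by
      have := w.2
      omega
    rw [this]
  have H₂ := H₁.frame f₂ (by decide)
  refine (does_checkPair H₂ hb (D := D) (fun x => ?_) v ⟨j, hj⟩ ⟨i, hi⟩ ?_ ?_ hi₂).mono
    fun s₃ h₃ _ => ?_
  · rw [f₂.arr 1 rfl, f₁.arr 1 rfl]; exact hD x
  · rw [f₂.reg 5 rfl, f₁.reg 5 rfl]; simpa using hv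
  · rw [f₂.reg 6 rfl]; exact hj₁
  · rw [h₃, h₂]
    by_cases hbad : BadPair G D v ⟨j, hj⟩ ⟨i, hi⟩
    · rw [if_pos hbad, if_neg]
      intro hc
      exact hc _ _ (.inr ⟨rfl, Nat.lt_succ_self i⟩) hbad
    · rw [if_neg hbad]
      congr 1
      refine propext ⟨fun h u w huw => ?_, fun h u w huw => h u w (by omega)⟩
      by_cases hc : (u : ℕ) = j ∧ (w : ℕ) = i
      · obtain rfl : u = ⟨j, hj⟩ := Fin.ext hc.1
        obtain rfl : w = ⟨i, hi⟩ := Fin.ext hc.2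
        exact hbad
      · exact h u w (by omega)

open Classical in
theorem does_findSimplicial (hs : Holds G s) (hb : SmallOk n b) {D : List (Fin n)}
    (hD : ∀ v : Fin n, s.arr 1 v = if v ∈ D then 1 else 0)
    (hex : ∃ v, v ∉ D ∧ IsSimplicialIn G {x | x ∉ D} v) :
    Does b n Prog.findSimplicial s
      (fun s' => ∃ v : Fin n, v ∉ D ∧ IsSimplicialIn G {x | x ∉ D} v ∧ s'.reg 9 = (v : ℕ)) := by
  -- Register `9` is meaningless until a simplicial vertex has been met; later hits may overwrite
  -- it.
  refine Does.forAll (fun j s' =>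
      (∃ v : Fin n, (v : ℕ) < j ∧ v ∉ D ∧ IsSimplicialIn G {x | x ∉ D} v) →
        ∃ v : Fin n, v ∉ D ∧ IsSimplicialIn G {x | x ∉ D} v ∧ s'.reg 9 = (v : ℕ))
    (by decide) hb.index hs.size hs.one (fun j s q h => by simpa using h) (by simp)
    (fun j hj s₁ h₁ hj₁ f₁ => ?_) (fun s₁ h₁ _ => ?_)
  swap
  · obtain ⟨v, hv⟩ := hex
    exact h₁ ⟨v, v.2, hv⟩
  have H₁ := hs.frame f₁ (by decide)
  have hD₁ : ∀ v : Fin n, s₁.arr 1 v = if v ∈ D then 1 else 0 := by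
    rw [f₁.arr 1 rfl]; exact hD
  -- a vertex that is not chosen leaves the invariant alone
  have hno : ¬ ((⟨j, hj⟩ : Fin n) ∉ D ∧ IsSimplicialIn G {x | x ∉ D} (⟨j, hj⟩ : Fin n)) →
      (∃ v : Fin n, (v : ℕ) < j + 1 ∧ v ∉ D ∧ IsSimplicialIn G {x | x ∉ D} v) →
        ∃ v : Fin n, v ∉ D ∧ IsSimplicialIn G {x | x ∉ D} v ∧ s₁.reg 9 = (v : ℕ) := by
    rintro hbad ⟨v, hvj, hv⟩
    refine h₁ ⟨v, lt_of_le_of_ne (Nat.lt_succ_iff.1 hvj) fun hc => hbad ?_, hv⟩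
    obtain rfl : v = ⟨j, hj⟩ := Fin.ext hc
    exact hv
  refine Does.seq (Does.load j _ hj₁ (hD₁ ⟨j, hj⟩) (hb.bit _) ?_)
  refine Does.ite (fun h => ?_) (fun h => Does.skip ?_)
  swap
  · have : (⟨j, hj⟩ : Fin n) ∈ D := by by_contra hc; simp [hc, H₁.one] at h
    simpa using hno (fun hc => hc.1 this)
  have hjD : (⟨j, hj⟩ : Fin n) ∉ D := by intro hc; simp [hc, H₁.one] at h
  refine Does.seq ((does_checkSimplicial (G := G) (D := D) ?_ hb ?_ ⟨j, hj⟩ ?_).mono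
    fun s₂ h₂ f₂ => ?_)
  · exact ⟨by simpa using H₁.size, by simpa using H₁.one, by simpa using H₁.zero, H₁.adj⟩
  · simpa using hD₁
  · simpa using hj₁
  have e3 : s₂.reg 3 = 0 := by rw [f₂.reg 3 rfl]; simpa using H₁.zero
  have e9 : s₂.reg 9 = s₁.reg 9 := by rw [f₂.reg 9 rfl]; simp
  have e5 : s₂.reg 5 = j := by rw [f₂.reg 5 rfl]; simpa using hj₁
  refine Does.ite (fun h => Does.arith (j : ℚ) (by simp [Op.eval, e5, e3]) (hb.index j hj.le) ?_)
    (fun h => Does.skip ?_)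
  · intro _
    refine ⟨⟨j, hj⟩, hjD, ?_, by simp⟩
    by_contra hc
    simp [h₂, hc, e3] at h
  · rw [e9]
    refine hno fun hc => h ?_
    rw [h₂, if_pos hc.2, e3]
    exact one_pos

open Classical in
theorem does_findOrder (hG : IsChordal G) (hs : Holds G s) (hb : SmallOk n b)
    (hD : ∀ v : Fin n, s.arr 1 v = 0) :
    Does b n Prog.findOrder s (fun s' => ∃ L : List (Fin n), L.length = n ∧ IsElimOrder G L ∧
      ∀ (i : ℕ) (hi : i < L.length), s'.arr 2 i = ((L[i] : Fin n) : ℕ)) := by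
  -- Elimination orders are defined from the tail but built from the front. The invariant therefore
  -- says that any elimination order of further vertices completes `L`.
  refine Does.forAll (fun j s' => ∃ L : List (Fin n), L.length = j ∧ L.Nodup ∧
      (∀ l, (L ++ l).Nodup → IsElimOrder G l → IsElimOrder G (L ++ l)) ∧
      (∀ v : Fin n, s'.arr 1 v = if v ∈ L then 1 else 0) ∧
      ∀ (i : ℕ) (hi : i < L.length), s'.arr 2 i = ((L[i] : Fin n) : ℕ))
    (by decide) hb.index hs.size hs.one (fun j s q h => by simpa using h)
    ⟨[], rfl, by simp, by simp, by simpa using hD, by simp⟩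
    (fun j hj s₁ h₁ hj₁ f₁ => ?_) (fun s₁ h₁ _ => ?_)
  swap
  · obtain ⟨L, hL, hnd, hcont, -, hord⟩ := h₁
    exact ⟨L, hL, by simpa using hcont [] (by simpa using hnd) trivial, hord⟩
  obtain ⟨L, hL, hnd, hcont, hdead, hord⟩ := h₁
  have H₁ := hs.frame f₁ (by decide)
  have hex : ∃ v, v ∉ L ∧ IsSimplicialIn G {x | x ∉ L} v := by
    have hne : (L.toFinsetᶜ).Nonempty := by
      rw [← Finset.card_pos, Finset.card_compl, List.toFinset_card_of_nodup hnd, hL,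
        Fintype.card_fin]
      omega
    obtain ⟨z, hz, hzs⟩ := hG.exists_isSimplicialIn _ hne
    have hz' : z ∉ L := by simpa using hz
    exact ⟨z, hz', fun a ha b hb => hzs a (by simpa using ha) b (by simpa using hb)⟩
  refine Does.seq ((does_findSimplicial H₁ hb hdead hex).mono fun s₂ h₂ f₂ => ?_)
  obtain ⟨v, hvL, hvs, hv⟩ := h₂
  have e4 : s₂.reg 4 = j := by rw [f₂.reg 4 rfl]; exact hj₁
  refine Does.seq (Does.store j _ e4 hv (hb.index v v.2.le) ?_)
  refine Does.store v 1 (by simpa using hv) ?_ hb.one ?_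
  · rw [State.reg_setArr, f₂.reg 2 rfl]; exact H₁.one
  refine ⟨L ++ [v], by simp [hL], ?_, ?_, ?_, ?_⟩
  · rw [List.nodup_append]
    refine ⟨hnd, by simp, ?_⟩
    rintro a ha _ hb rfl
    exact hvL (by simpa [List.mem_singleton.1 hb] using ha)
  · intro l hl hle
    rw [List.append_assoc, List.singleton_append] at hl ⊢
    refine hcont _ hl ⟨?_, ?_, hle⟩
    · exact (List.nodup_cons.1 (List.nodup_append.1 hl).2.1).1
    · have hdis : ∀ x ∈ l, x ∉ L := fun x hx hxL =>
        (List.nodup_append.1 hl).2.2 x hxL x (List.mem_cons_of_mem _ hx) rfl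
      exact fun a ha b hb => hvs a (hdis a ha) b (hdis b hb)
  · intro x
    have h1 : s₂.arr 1 x = if x ∈ L then 1 else 0 := by rw [f₂.arr 1 rfl]; exact hdead x
    by_cases hxv : x = v
    · subst hxv; simp [State.arr_setArr]
    · have : (x : ℕ) ≠ v := fun h => hxv (Fin.ext h)
      simp [State.arr_setArr, this, h1, hxv]
  · intro i hi
    by_cases hij : i = j
    · subst hij
      subst hL
      simp [State.arr_setArr]
    · have hiL : i < L.length := by
        rw [List.length_append, List.length_singleton] at hi
        omega
      rw [List.getElem_append_left hiL, ← hord i hiL, ← f₂.arr 2 rfl]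
      simp [State.arr_setArr, hij]

end OrderProgram

/-! ### The feasibility test and the search -/

section SearchProgram

/-- Update the weight at position `6` of the order after the elimination of the vertex in register
`5` at position `4`; register `19` holds the divisor. -/
def Prog.updateWeight : Prog :=
  .ite 4 6
    (.seq (.load 7 2 6) (.seq (.adj 10 5 7) (.ite 3 10
      (.seq (.load 18 3 6) (.seq (.arith .div 18 18 19) (.store 3 6 18))) .skip)))
    .skip

/-- Eliminate the vertex at position `4`, or set register `17` to one if its weight is too large. -/
def Prog.eliminate : Prog :=
  .seq (.load 18 3 4) (.ite 18 2
    (.seq (.arith .sub 19 2 18) (.seq (.load 5 2 4) (.forAll 6 .updateWeight)))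
    (.const 17 1))

/-- Set register `17` to zero or one according to whether the constant weight `1 / y` is feasible,
where `y` is in register `15`. Array `3` holds the weights, in the elimination order. -/
def Prog.test : Prog :=
  .seq (.arith .div 16 2 15) (.seq (.const 17 0) (.seq (.forAll 6 (.store 3 6 16))
    (.forAll 4 (.ite 17 2 .eliminate .skip))))

/-- Add register `14` to register `13` if the sum is not too large. -/
def Prog.advance : Prog :=
  .seq (.arith .add 15 13 14) (.seq .test (.ite 3 17 (.arith .add 13 13 14) .skip))

/-- Compute the order and the integer part of the result. -/
def Prog.integerPart : Prog :=
  .seq (.const 2 1) (.seq .findOrder (.seq (.const 14 1) (.seq (.forAll 20 .advance)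
    (.seq (.const 21 2) (.const 22 0)))))

/-- One step of the bisection. -/
def Prog.bisect : Prog :=
  .seq (.arith .div 14 14 21) .advance

/-- The algorithm. -/
def Prog.main : Prog :=
  .seq .integerPart (.seq (.loop 22 1 (.seq .bisect (.arith .add 22 22 2))) (.arith .add 0 13 3))

variable {n b : ℕ} {G : SimpleGraph (Fin n)} {s : State} {L : List (Fin n)}

/-- The weight of the vertex `u` after the elimination of the first `j` vertices. -/
noncomputable def weightAt (G : SimpleGraph (Fin n)) (L : List (Fin n)) (x : ℚ) (j : ℕ) :
    Fin n → ℚ :=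
  weightAfter G (L.take j) fun _ => x

theorem weightAt_succ {x : ℚ} {j : ℕ} (hj : j < L.length) :
    weightAt G L x (j + 1) = reweight G L[j] (weightAt G L x j) := by
  unfold weightAt
  rw [List.take_succ_eq_append_getElem hj, weightAfter_append]
  rfl

theorem feasible_take_succ {x : ℚ} {j : ℕ} (hj : j < L.length) :
    Feasible G (L.take (j + 1)) (fun _ => x) ↔
      Feasible G (L.take j) (fun _ => x) ∧ weightAt G L x j L[j] < 1 := by
  rw [List.take_succ_eq_append_getElem hj, feasible_append]
  simp [Feasible, weightAt]

theorem Feasible.take {x : ℚ} (h : Feasible G L fun _ => x) (j : ℕ) :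
    Feasible G (L.take j) fun _ => x := by
  rw [← List.take_append_drop j L, feasible_append] at h
  exact h.1

/-- The numbers that occur in the elimination at the constant weight `x` may be written. -/
structure WeightsOk (G : SimpleGraph (Fin n)) (L : List (Fin n)) (x : ℚ) (b : ℕ) : Prop where
  start : bitLength x ≤ b
  weight : ∀ (j i : ℕ) (hi : i < L.length), j ≤ i → Feasible G (L.take j) (fun _ => x) →
    bitLength (weightAt G L x j L[i]) ≤ b
  divisor : ∀ (j i : ℕ) (hi : i < L.length), j ≤ i → Feasible G (L.take j) (fun _ => x) →
    bitLength (1 - weightAt G L x j L[i]) ≤ b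

/-- Array `2` holds the elimination order `L`. -/
def HoldsOrder (L : List (Fin n)) (s : State) : Prop :=
  ∀ (i : ℕ) (hi : i < L.length), s.arr 2 i = ((L[i] : Fin n) : ℕ)

theorem HoldsOrder.frame {P : Prog} {s' : State} (h : HoldsOrder L s) (hf : Frame P s s')
    (hP : P.writesArr 2 = false) : HoldsOrder L s' := by
  intro i hi
  rw [hf.arr 2 hP]
  exact h i hi

/-- Only positions after `j` matter: the weights of eliminated vertices are stale and not read again
during the test. -/
theorem does_updateWeight {x : ℚ} {i j : ℕ} (hs : Holds G s) (hb : SmallOk n b)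
    (ho : HoldsOrder L s) (hx : WeightsOk G L x b)
    (hi : i < L.length) (hj : j < L.length)
    (hf : Feasible G (L.take (j + 1)) (fun _ => x)) (h4 : s.reg 4 = j) (h6 : s.reg 6 = i)
    (h5 : s.reg 5 = ((L[j] : Fin n) : ℕ)) (h19 : s.reg 19 = 1 - weightAt G L x j L[j])
    (h3 : j < i → s.arr 3 i = weightAt G L x j L[i]) :
    Does b n Prog.updateWeight s (fun s' => (j < i → s'.arr 3 i = weightAt G L x (j + 1) L[i]) ∧
      ∀ m, m ≠ i → s'.arr 3 m = s.arr 3 m) := by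
  have hfj := ((feasible_take_succ hj).1 hf).1
  refine Does.ite (fun h => ?_) (fun h => Does.skip ?_)
  swap
  · rw [h4, h6] at h
    exact ⟨fun h' => absurd (by exact_mod_cast h') h, fun _ _ => rfl⟩
  have hji : j < i := by rw [h4, h6] at h; exact_mod_cast h
  have h3 := h3 hji
  refine Does.seq (Does.load i _ h6 (ho i hi) (hb.index _ (L[i]).2.le) (Does.seq ?_))
  refine (does_adj (G := G) (s := s.setReg 7 ((L[i] : Fin n) : ℕ))
    ⟨by simpa using hs.size, by simpa using hs.one, by simpa using hs.zero, hs.adj⟩ hb (ru := 5)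
    (rv := 7) L[j] L[i] (by simpa using h5) (by simp) (by decide)).mono fun s₁ h₁ f₁ => ?_
  have e3 : s₁.reg 3 = 0 := by rw [f₁.reg 3 rfl]; simpa using hs.zero
  have e6 : s₁.reg 6 = i := by rw [f₁.reg 6 rfl]; simpa using h6
  have e19 : s₁.reg 19 = 1 - weightAt G L x j L[j] := by rw [f₁.reg 19 rfl]; simpa using h19
  have a3 : s₁.arr 3 = s.arr 3 := f₁.arr 3 rfl
  refine Does.ite (fun h => ?_) (fun h => Does.skip ?_)
  swap
  · have hna : ¬ G.Adj L[j] L[i] := by intro hc; simp [h₁, hc, e3] at h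
    refine ⟨fun _ => ?_, fun m _ => by rw [a3]⟩
    rw [a3, h3, weightAt_succ hj, reweight, if_neg hna]
  have ha : G.Adj L[j] L[i] := by by_contra hc; simp [h₁, hc, e3] at h
  have hval : weightAt G L x (j + 1) L[i] =
      weightAt G L x j L[i] / (1 - weightAt G L x j L[j]) := by
    rw [weightAt_succ hj, reweight, if_pos ha]
  refine Does.seq (Does.load i _ e6 (by rw [a3, h3]) (hx.weight j i hi hji.le hfj) ?_)
  refine Does.seq (Does.arith (weightAt G L x (j + 1) L[i]) (by simp [Op.eval, e19, hval])
    (hx.weight (j + 1) i hi hji hf) ?_)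
  refine Does.store i (weightAt G L x (j + 1) L[i]) (by simpa using e6) (by simp)
    (hx.weight (j + 1) i hi hji hf) ⟨fun _ => by simp [State.arr_setArr], fun m hm => ?_⟩
  simp [State.arr_setArr, hm, a3]

/-- A weight of at least `1` at position `j` refutes feasibility of the whole order, because
feasibility passes to initial segments. -/
theorem does_eliminate {x : ℚ} {j : ℕ} (hs : Holds G s) (hb : SmallOk n b)
    (hL : L.length = n) (ho : HoldsOrder L s) (hx : WeightsOk G L x b) (hj : j < L.length)
    (hf : Feasible G (L.take j) (fun _ => x)) (h4 : s.reg 4 = j) (h17 : s.reg 17 = 0)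
    (h3 : ∀ (i : ℕ) (hi : i < L.length), j ≤ i → s.arr 3 i = weightAt G L x j L[i]) :
    Does b n Prog.eliminate s (fun s' =>
      (s'.reg 17 = 0 ∧ Feasible G (L.take (j + 1)) (fun _ => x) ∧
        ∀ (i : ℕ) (hi : i < L.length), j + 1 ≤ i → s'.arr 3 i = weightAt G L x (j + 1) L[i]) ∨
      (s'.reg 17 = 1 ∧ ¬ Feasible G L fun _ => x)) := by
  refine Does.seq (Does.load j _ h4 (h3 j hj le_rfl) (hx.weight j j hj le_rfl hf) ?_)
  refine Does.ite (fun h => ?_) (fun h => Does.const hb.one (.inr ⟨by simp, fun hc => ?_⟩))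
  swap
  · exact h (by simpa [hs.one] using ((feasible_take_succ hj).1 (hc.take (j + 1))).2)
  have hlt : weightAt G L x j L[j] < 1 := by simpa [hs.one] using h
  have hf' := (feasible_take_succ hj).2 ⟨hf, hlt⟩
  refine Does.seq (Does.arith (1 - weightAt G L x j L[j]) (by simp [Op.eval, hs.one])
    (hx.divisor j j hj le_rfl hf) ?_)
  refine Does.seq (Does.load j _ (by simpa using h4) (ho j hj) (hb.index _ (L[j]).2.le) ?_)
  generalize hs₁ : State.setReg _ _ _ = s₁
  have H₁ : Holds G s₁ := ⟨by simp [← hs₁, hs.size], by simp [← hs₁, hs.one],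
    by simp [← hs₁, hs.zero], by simpa [← hs₁] using hs.adj⟩
  have e4 : s₁.reg 4 = j := by simp [← hs₁, h4]
  have e5 : s₁.reg 5 = ((L[j] : Fin n) : ℕ) := by simp [← hs₁]
  have e17 : s₁.reg 17 = 0 := by simp [← hs₁, h17]
  have e19 : s₁.reg 19 = 1 - weightAt G L x j L[j] := by simp [← hs₁]
  have ho₁ : HoldsOrder L s₁ := by rw [← hs₁]; exact ho
  have a3 : s₁.arr 3 = s.arr 3 := by simp [← hs₁]
  clear hs₁
  refine Does.forAll (fun m s' => ∀ (i : ℕ) (hi : i < L.length), j < i →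
      s'.arr 3 i = if i < m then weightAt G L x (j + 1) L[i] else weightAt G L x j L[i])
    (by decide) hb.index H₁.size H₁.one (fun j s q h => by simpa using h)
    (fun i hi hji => by rw [a3]; simpa using h3 i hi hji.le)
    (fun m hm s₂ h₂ hm₂ f₂ => ?_) (fun s₂ h₂ f₂ => .inl ⟨?_, hf', fun i hi hji => ?_⟩)
  · refine (does_updateWeight (H₁.frame f₂ (by decide)) hb (ho₁.frame f₂ rfl) hx
      (hm.trans_eq hL.symm) hj hf' (by rw [f₂.reg 4 rfl, e4]) hm₂ (by rw [f₂.reg 5 rfl, e5])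
      (by rw [f₂.reg 19 rfl, e19]) (fun hjm => by simpa using h₂ m _ hjm)).mono
      fun s₃ h₃ _ i hi hji => ?_
    by_cases him : i = m
    · subst him
      rw [h₃.1 hji, if_pos (Nat.lt_succ_self _)]
    · rw [h₃.2 i him, h₂ i hi hji]
      have : i < m + 1 ↔ i < m := by omega
      simp only [this]
  · rw [f₂.reg 17 rfl, e17]
  · rw [h₂ i hi hji, if_pos (by omega)]

open Classical in
theorem does_test {y : ℚ} (hs : Holds G s) (hb : SmallOk n b) (hL : L.length = n)
    (ho : HoldsOrder L s) (hx : WeightsOk G L (1 / y) b) (h15 : s.reg 15 = y) :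
    Does b n Prog.test s
      (fun s' => s'.reg 17 = if Feasible G L (fun _ => 1 / y) then 0 else 1) := by
  refine Does.seq (Does.arith (1 / y) (by simp [Op.eval, hs.one, h15]) hx.start ?_)
  refine Does.seq (Does.const hb.zero ?_)
  generalize hs₁ : State.setReg _ _ _ = s₁
  have H₁ : Holds G s₁ := ⟨by simp [← hs₁, hs.size], by simp [← hs₁, hs.one],
    by simp [← hs₁, hs.zero], by simpa [← hs₁] using hs.adj⟩
  have e16 : s₁.reg 16 = 1 / y := by simp [← hs₁]
  have e17 : s₁.reg 17 = 0 := by simp [← hs₁]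
  have ho₁ : HoldsOrder L s₁ := by rw [← hs₁]; exact ho
  clear hs₁
  refine Does.seq (Does.forAll (fun m s' => ∀ i < m, s'.arr 3 i = 1 / y) (by decide) hb.index
    H₁.size H₁.one (fun j s q h => by simpa using h) (by simp)
    (fun m hm s₂ h₂ hm₂ f₂ => ?_) (fun s₂ h₂ f₂ => ?_))
  · refine Does.store m (1 / y) hm₂ (by rw [f₂.reg 16 rfl, e16]) hx.start fun i hi => ?_
    by_cases him : i = m
    · simp [State.arr_setArr, him]
    · simpa [State.arr_setArr, him] using h₂ i (by omega)
  have H₂ := H₁.frame f₂ (by decide)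
  -- Once the flag is set, the remaining rounds do nothing. Hence all divisors are positive, and
  -- numbers beyond the first failure need no bound.
  refine Does.forAll (fun j s' =>
      (s'.reg 17 = 0 ∧ Feasible G (L.take j) (fun _ => 1 / y) ∧
        ∀ (i : ℕ) (hi : i < L.length), j ≤ i → s'.arr 3 i = weightAt G L (1 / y) j L[i]) ∨
      (s'.reg 17 = 1 ∧ ¬ Feasible G L fun _ => 1 / y))
    (by decide) hb.index H₂.size H₂.one (fun j s q h => by simpa using h)
    (.inl ⟨by rw [f₂.reg 17 rfl, e17], by simp [Feasible],
      fun i hi _ => by rw [h₂ i (hi.trans_eq hL)]; simp [weightAt, weightAfter]⟩)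
    (fun j hj s₃ h₃ hj₃ f₃ => ?_) (fun s₃ h₃ _ => ?_)
  swap
  · rcases h₃ with ⟨h17, hf, -⟩ | ⟨h17, hf⟩
    · rw [List.take_of_length_le hL.le] at hf
      rw [h17, if_pos hf]
    · rw [h17, if_neg hf]
  have H₃ := H₂.frame f₃ (by decide)
  rcases h₃ with ⟨h17, hf, h3⟩ | ⟨h17, hf⟩
  · refine Does.ite (fun _ => ?_) (fun h => absurd ?_ h)
    · exact does_eliminate H₃ hb hL ((ho₁.frame f₂ rfl).frame f₃ rfl) hx (hj.trans_eq hL.symm) hf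
        hj₃ h17 h3
    · rw [h17, H₃.one]; exact one_pos
  · refine Does.ite (fun h => absurd h ?_) (fun _ => Does.skip (.inr ⟨h17, hf⟩))
    rw [h17, H₃.one]; exact lt_irrefl _

open Classical in
theorem does_advance {z d : ℚ} (hn : 1 ≤ n) (hs : Holds G s) (hb : SmallOk n b) (hL : L.length = n)
    (hl : IsElimOrder G L) (ho : HoldsOrder L s) (hx : WeightsOk G L (1 / (z + d)) b)
    (hy : bitLength (z + d) ≤ b) (hpos : 0 < z + d) (h13 : s.reg 13 = z) (h14 : s.reg 14 = d) :
    Does b n Prog.advance s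
      (fun s' => s'.reg 13 = if ((z + d : ℚ) : ℝ) ≤ fracHatNumber G then z + d else z) := by
  have : Nonempty (Fin n) := ⟨⟨0, hn⟩⟩
  have hall : ∀ v, v ∈ L := by
    intro v
    have : L.toFinset = Finset.univ := by
      rw [← Finset.card_eq_iff_eq_univ, List.toFinset_card_of_nodup hl.nodup, hL, Fintype.card_fin]
    rw [← List.mem_toFinset, this]
    exact Finset.mem_univ v
  have hiff := hl.le_fracHatNumber_iff hall hpos
  refine Does.seq (Does.arith (z + d) (by simp [Op.eval, h13, h14]) hy (Does.seq ?_))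
  refine (does_test (G := G) (L := L) (y := z + d) (s := s.setReg 15 (z + d))
    ⟨by simpa using hs.size, by simpa using hs.one, by simpa using hs.zero, hs.adj⟩ hb hL ho hx (by simp)).mono fun s₁ h₁ f₁ => ?_
  have e3 : s₁.reg 3 = 0 := by rw [f₁.reg 3 rfl]; simpa using hs.zero
  have e13 : s₁.reg 13 = z := by rw [f₁.reg 13 rfl]; simpa using h13
  have e14 : s₁.reg 14 = d := by rw [f₁.reg 14 rfl]; simpa using h14
  refine Does.ite (fun h => Does.arith (z + d) (by simp [Op.eval, e13, e14]) hy ?_)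
    (fun h => Does.skip ?_)
  · rw [if_pos (hiff.2 fun hc => ?_)]
    · simp
    · rw [h₁, if_pos hc, e3] at h
      exact lt_irrefl _ h
  · rw [e13, if_neg fun hc => h ?_]
    rw [h₁, if_neg (hiff.1 hc), e3]
    exact one_pos

end SearchProgram

/-! ### Bit bounds, integer part, bisection, and the correctness of the algorithm -/

section Main

variable {n b : ℕ} {G : SimpleGraph (Fin n)} {L : List (Fin n)}

/-- The weights that occur in the elimination at `a / c` have short numerators and denominators. -/
theorem IsElimOrder.weightsOk (hl : IsElimOrder G L) (hL : L.length = n) {a c e : ℕ}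
    (ha : a < 2 ^ e) (hc : c < 2 ^ e) (hc0 : 0 < c) (hbe : 2 * e ≤ b)
    (hb : 2 * ((e + 1) * n + 2) ≤ b) : WeightsOk G L ((a : ℚ) / c) b := by
  have hstart : bitLength ((a : ℚ) / c) ≤ b := by
    have := bitLength_div_le (N := a) (D := c) (by exact_mod_cast hc0.ne') (m := e)
      (by simpa using ha) (by simpa using hc)
    exact (by simpa using this : bitLength ((a : ℚ) / c) ≤ 2 * e).trans hbe
  -- By `indepVal_concat`, one minus the weight is the quotient of the values for the first `j`
  -- vertices with and without `L[i]`. Clearing the denominators `c ^ (j + 1)` and `c ^ j` leaves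
  -- one factor `c` below.
  have key : ∀ (j i : ℕ) (hi : i < L.length), j ≤ i →
      Feasible G (L.take j) (fun _ => (a : ℚ) / c) →
      ∃ N D : ℤ, D ≠ 0 ∧ N.natAbs < 2 ^ ((e + 1) * n + 1) ∧ D.natAbs < 2 ^ ((e + 1) * n + 1) ∧
        1 - weightAt G L ((a : ℚ) / c) j L[i] = (N : ℚ) / D := by
    intro j i hi hji hf
    have hsub : (L.take j ++ [L[i]]).Sublist L := by
      have h1 : [L[i]].Sublist (L.drop j) := by
        rw [List.singleton_sublist, List.mem_drop_iff_getElem]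
        exact ⟨i - j, by omega, by congr 1; omega⟩
      have := (List.Sublist.refl (L.take j)).append h1
      rwa [List.take_append_drop] at this
    have hcat := (hl.sublist hsub).indepVal_concat hf
    have hpos := (hl.sublist (List.take_sublist j L)).indepVal_pos hf
    obtain ⟨M, hM, hM'⟩ := exists_int_indepVal G (L.take j) a c hc0
    obtain ⟨N, hN, hN'⟩ := exists_int_indepVal G (L.take j ++ [L[i]]) a c hc0
    have hlen : (L.take j).length = j := by rw [List.length_take]; omega
    rw [List.length_append, hlen, List.length_singleton] at hN hN'
    rw [hlen] at hM hM'
    have hcq : (0 : ℚ) < c := by exact_mod_cast hc0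
    have hM0 : (0 : ℚ) < M := by rw [← hM]; positivity
    have hac : (a + c) ^ (j + 1) < 2 ^ ((e + 1) * n + 1) := by
      have h1 : a + c ≤ 2 ^ (e + 1) := by rw [pow_succ]; omega
      calc (a + c) ^ (j + 1) ≤ (2 ^ (e + 1)) ^ (j + 1) := Nat.pow_le_pow_left h1 _
        _ ≤ (2 ^ (e + 1)) ^ n := Nat.pow_le_pow_right (by positivity) (by omega)
        _ = 2 ^ ((e + 1) * n) := by rw [← pow_mul]
        _ < _ := Nat.pow_lt_pow_right (by norm_num) (by omega)
    refine ⟨N, c * M, ?_, ?_, ?_, ?_⟩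
    · have : (0 : ℤ) < M := by exact_mod_cast hM0
      positivity
    · refine lt_of_le_of_lt ?_ hac
      zify
      exact_mod_cast hN'
    · refine lt_of_le_of_lt ?_ hac
      zify
      rw [abs_mul, pow_succ, mul_comm]
      have : |(c : ℤ)| ≤ (a : ℤ) + c := by
        rw [abs_of_nonneg (by positivity)]
        omega
      push_cast at hM'
      gcongr
    · push_cast
      rw [← hM, ← hN, hcat]
      unfold weightAt
      field_simp
      ring
  refine ⟨hstart, fun j i hi hji hf => ?_, fun j i hi hji hf => ?_⟩
  · obtain ⟨N, D, hD, hN, hD', heq⟩ := key j i hi hji hf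
    have hDq : (D : ℚ) ≠ 0 := by exact_mod_cast hD
    have hval : weightAt G L ((a : ℚ) / c) j L[i] = ((D - N : ℤ) : ℚ) / D := by
      push_cast
      rw [sub_div, div_self hDq, ← heq]
      ring
    rw [hval]
    -- The difference `D - N` may need one more bit than `D` and `N`.
    refine (bitLength_div_le hD (m := (e + 1) * n + 2) ?_ ?_).trans hb
    · rw [pow_succ]; omega
    · rw [pow_succ]; omega
  · obtain ⟨N, D, hD, hN, hD', heq⟩ := key j i hi hji hf
    rw [heq]
    exact (bitLength_div_le hD hN hD').trans (by omega)

/-- The bit length that suffices for inputs with `n` vertices and accuracy `1`. -/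
noncomputable def bitBound : Polynomial ℕ :=
  2 * ((Polynomial.X + 3) * Polynomial.X + 2) + 2 * (Polynomial.X + 3) +
    (Polynomial.X * Polynomial.X + 4)

theorem bitBound_eval (n : ℕ) :
    bitBound.eval n = 2 * ((n + 3) * n + 2) + 2 * (n + 3) + (n * n + 4) := by
  simp [bitBound]

variable {k : ℕ}

theorem smallOk_bitBound (hk : 1 ≤ k) : SmallOk n (k * bitBound.eval n) := by
  intro m hm
  refine (bitLength_natCast_le hm).trans ?_
  rw [bitBound_eval]
  nlinarith

/-- These are the requirements of `weightsOk` at `e = n + k + 1`; the bound stays linear in `k`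
because `n + k + 2 ≤ k * (n + 3)`. -/
theorem exponent_le (hk : 1 ≤ k) : 2 * (n + k + 2) ≤ k * bitBound.eval n ∧
    2 * ((n + k + 2) * n + 2) ≤ k * bitBound.eval n := by
  have h : n + k + 2 ≤ k * (n + 3) := by nlinarith
  rw [bitBound_eval]
  constructor
  · nlinarith
  · have : (n + k + 2) * n ≤ k * (n + 3) * n := Nat.mul_le_mul_right _ h
    nlinarith

/-- A dyadic number `c / 2 ^ j` and the elimination at its inverse fit into the bit bound. -/
theorem IsElimOrder.dyadic_ok (hl : IsElimOrder G L) (hL : L.length = n) (hk : 1 ≤ k) {c j : ℕ}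
    (hj : j ≤ k) (hc0 : 0 < c) (hc : c ≤ (n + 1) * 2 ^ j) :
    bitLength ((c : ℚ) / 2 ^ j) ≤ k * bitBound.eval n ∧
      WeightsOk G L (1 / ((c : ℚ) / 2 ^ j)) (k * bitBound.eval n) := by
  obtain ⟨h1, h2⟩ := exponent_le (n := n) hk
  have hjk : 2 ^ j ≤ 2 ^ k := Nat.pow_le_pow_right (by norm_num) hj
  have hn : n + 1 ≤ 2 ^ n := Nat.lt_two_pow_self
  have hnk : (n + 1) * 2 ^ j ≤ 2 ^ (n + k) := by
    rw [pow_add]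
    exact Nat.mul_le_mul hn hjk
  have hlt : 2 ^ (n + k) < 2 ^ (n + k + 1) := Nat.pow_lt_pow_right (by norm_num) (by omega)
  have hc' : c < 2 ^ (n + k + 1) := by omega
  have hj' : 2 ^ j < 2 ^ (n + k + 1) := Nat.pow_lt_pow_right (by norm_num) (by omega)
  constructor
  · have := bitLength_div_le (N := c) (D := 2 ^ j) (by positivity) (m := n + k + 1)
      (by simpa using hc') (by simpa [Int.natAbs_pow] using hj')
    push_cast at this
    exact this.trans (by omega)
  · have := hl.weightsOk hL (a := 2 ^ j) (c := c) (e := n + k + 1) hj' hc' hc0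
      (b := k * bitBound.eval n) (by omega) h2
    rw [one_div_div]
    exact_mod_cast this

/-- Division by `n` with remainder recovers `u` and `v` from the index, so matrix entries do not
collide. -/
theorem holds_input (G : SimpleGraph (Fin n)) (k : ℕ) :
    Holds G ((input G k).setReg 2 1) := by
  classical
  refine ⟨by simp [input], by simp, by simp [input], fun u v => ?_⟩
  simp only [State.arr_setReg, input, true_and]
  congr 1
  refine propext ⟨?_, fun h => ⟨u, v, h, rfl⟩⟩
  rintro ⟨u', v', h, heq⟩
  have hn : 0 < n := u.pos
  have h1 : (u : ℕ) = u' := by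
    have := congrArg (· / n) heq
    simpa [Nat.mul_add_div hn, Nat.div_eq_of_lt] using this
  have h2 : (v : ℕ) = v' := by
    rw [h1] at heq
    omega
  rwa [Fin.ext h1, Fin.ext h2]

theorem does_integerPart (hn : 1 ≤ n) (hG : IsChordal G) (hk : 1 ≤ k) :
    Does (k * bitBound.eval n) n Prog.integerPart (input G k) (fun s =>
      Holds G s ∧ s.reg 1 = k ∧ s.reg 14 = 1 ∧ s.reg 21 = 2 ∧ s.reg 22 = 0 ∧
      (∃ L : List (Fin n), L.length = n ∧ IsElimOrder G L ∧ HoldsOrder L s) ∧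
      ∃ c : ℕ, s.reg 13 = c ∧ (c : ℝ) ≤ fracHatNumber G ∧ fracHatNumber G < c + 1) := by
  have hb := smallOk_bitBound (n := n) hk
  have : Nonempty (Fin n) := ⟨⟨0, hn⟩⟩
  have hone := one_le_fracHatNumber G
  have hcard : fracHatNumber G ≤ n := by simpa using fracHatNumber_le_card G
  refine Does.seq (Does.const hb.one (Does.seq ?_))
  have H₀ := holds_input G k
  refine (does_findOrder hG H₀ hb (by simp [input])).mono fun s₁ h₁ f₁ => ?_
  obtain ⟨L, hL, hl, ho⟩ := h₁
  have H₁ := H₀.frame f₁ (by decide)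
  have e1 : s₁.reg 1 = k := by rw [f₁.reg 1 rfl]; simp [input]
  have e13 : s₁.reg 13 = 0 := by rw [f₁.reg 13 rfl]; simp [input]
  refine Does.seq (Does.const hb.one (Does.seq ?_))
  have H₂ : Holds G (s₁.setReg 14 1) :=
    ⟨by simpa using H₁.size, by simpa using H₁.one, by simpa using H₁.zero, H₁.adj⟩
  have ho₂ : HoldsOrder L (s₁.setReg 14 1) := ho
  -- Either the integer part has been reached or all `i` rounds succeeded. In the latter case `c =
  -- n` at the end, and the hat number is at most `n`.
  refine Does.forAll (fun i s => ∃ c : ℕ, s.reg 13 = c ∧ (c : ℝ) ≤ fracHatNumber G ∧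
      (fracHatNumber G < c + 1 ∨ c = i))
    (by decide) hb.index H₂.size H₂.one (fun j s q h => by simpa using h)
    ⟨0, by simpa using e13, by simp; linarith, .inr rfl⟩
    (fun i hi s₂ h₂ hi₂ f₂ => ?_) (fun s₂ h₂ f₂ => ?_)
  · obtain ⟨c, h13, hle, hor⟩ := h₂
    have hcn : c ≤ n := by exact_mod_cast hle.trans hcard
    obtain ⟨hbit, hok⟩ := hl.dyadic_ok (c := c + 1) (j := 0) hL hk (by omega) (by omega)
      (by simpa using hcn)
    have hcast : ((c + 1 : ℕ) : ℚ) / 2 ^ 0 = (c : ℚ) + 1 := by simp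
    rw [hcast] at hbit hok
    refine (does_advance hn (H₂.frame f₂ (by decide)) hb hL hl (ho₂.frame f₂ rfl) hok hbit
      (by positivity) h13 (by rw [f₂.reg 14 rfl]; simp)).mono fun s₃ h₃ _ => ?_
    by_cases hlt : (((c : ℚ) + 1 : ℚ) : ℝ) ≤ fracHatNumber G
    · rw [if_pos hlt] at h₃
      push_cast at hlt
      refine ⟨c + 1, by rw [h₃]; push_cast; rfl, by push_cast; exact hlt, .inr ?_⟩
      rcases hor with h | h
      · linarith
      · omega
    · rw [if_neg hlt] at h₃
      push_cast at hlt
      exact ⟨c, h₃, hle, .inl (not_le.1 hlt)⟩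
  · obtain ⟨c, h13, hle, hor⟩ := h₂
    have H₃ := H₂.frame f₂ (by decide)
    have ho₃ := ho₂.frame f₂ rfl
    have e14 : s₂.reg 14 = 1 := by rw [f₂.reg 14 rfl]; simp
    have e1' : s₂.reg 1 = k := by rw [f₂.reg 1 rfl]; simpa using e1
    have hb2 : bitLength 2 ≤ k * bitBound.eval n := by simpa using hb 2 (by nlinarith)
    refine Does.seq (Does.const hb2 (Does.const hb.zero ?_))
    refine ⟨⟨by simpa using H₃.size, by simpa using H₃.one, by simpa using H₃.zero, H₃.adj⟩,
      by simpa using e1', by simpa using e14, by simp, by simp, ⟨L, hL, hl, ho₃⟩,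
      c, by simpa using h13, hle, ?_⟩
    rcases hor with h | h
    · exact h
    · rw [h]; linarith

/-- The midpoint of the current interval is `(2 * c + 1) / 2 ^ (j + 1)`, so the new numerator is `2
* c + 1` or `2 * c`. -/
theorem does_bisect {s : State} (hn : 1 ≤ n) (hk : 1 ≤ k) (hs : Holds G s) (hL : L.length = n)
    (hl : IsElimOrder G L) (ho : HoldsOrder L s) (h21 : s.reg 21 = 2) {c j : ℕ} (hj : j < k)
    (h13 : s.reg 13 = (c : ℚ) / 2 ^ j) (h14 : s.reg 14 = 1 / 2 ^ j)
    (hle : (c : ℝ) / 2 ^ j ≤ fracHatNumber G) (hlt : fracHatNumber G < ((c : ℝ) + 1) / 2 ^ j) :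
    Does (k * bitBound.eval n) n Prog.bisect s (fun s' => ∃ c : ℕ,
      s'.reg 13 = (c : ℚ) / 2 ^ (j + 1) ∧ s'.reg 14 = 1 / 2 ^ (j + 1) ∧
      (c : ℝ) / 2 ^ (j + 1) ≤ fracHatNumber G ∧
      fracHatNumber G < ((c : ℝ) + 1) / 2 ^ (j + 1)) := by
  have hb := smallOk_bitBound (n := n) hk
  have : Nonempty (Fin n) := ⟨⟨0, hn⟩⟩
  have hcard : fracHatNumber G ≤ n := by simpa using fracHatNumber_le_card G
  have hcn : c ≤ n * 2 ^ j := by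
    have := hle.trans hcard
    rw [div_le_iff₀ (by positivity)] at this
    exact_mod_cast this
  have hpow : 1 ≤ 2 ^ j := Nat.one_le_two_pow
  obtain ⟨hbit1, -⟩ := hl.dyadic_ok (c := 1) (j := j + 1) hL hk hj (by omega)
    (by rw [pow_succ]; nlinarith)
  obtain ⟨hbit, hok⟩ := hl.dyadic_ok (c := 2 * c + 1) (j := j + 1) hL hk hj (by omega)
    (by rw [pow_succ]; nlinarith)
  have hsum : ((2 * c + 1 : ℕ) : ℚ) / 2 ^ (j + 1) = (c : ℚ) / 2 ^ j + 1 / 2 ^ (j + 1) := by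
    push_cast
    field_simp
    ring
  have hsum' : ((2 * c + 1 : ℕ) : ℝ) / 2 ^ (j + 1) = (c : ℝ) / 2 ^ j + 1 / 2 ^ (j + 1) := by
    push_cast
    field_simp
    ring
  rw [hsum] at hbit hok
  have hhalf : (1 / 2 ^ j : ℚ) / 2 = 1 / 2 ^ (j + 1) := by field_simp; ring
  refine Does.seq (Does.arith (1 / 2 ^ (j + 1)) (by simp only [Op.eval, h14, h21, hhalf])
    (by simpa using hbit1) ?_)
  refine (does_advance (G := G) (L := L) (s := s.setReg 14 (1 / 2 ^ (j + 1))) hn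
    ⟨by simpa using hs.size, by simpa using hs.one, by simpa using hs.zero, hs.adj⟩ hb hL hl ho hok hbit (by positivity) (by simpa using h13)
    (by simp)).mono fun s₁ h₁ f₁ => ?_
  have e14 : s₁.reg 14 = 1 / 2 ^ (j + 1) := by rw [f₁.reg 14 rfl]; simp
  by_cases hc : (((c : ℚ) / 2 ^ j + 1 / 2 ^ (j + 1) : ℚ) : ℝ) ≤ fracHatNumber G
  · rw [if_pos hc] at h₁
    push_cast at hc
    refine ⟨2 * c + 1, by rw [h₁, hsum], e14, by rw [hsum']; exact hc, ?_⟩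
    refine hlt.trans_eq ?_
    push_cast
    field_simp
    ring
  · rw [if_neg hc] at h₁
    push_cast at hc
    refine ⟨2 * c, ?_, e14, le_of_eq_of_le ?_ hle, ?_⟩
    · rw [h₁]; push_cast; field_simp; ring
    · push_cast; field_simp; ring
    · rw [← hsum'] at hc
      push_cast at hc ⊢
      exact not_le.1 hc

theorem halts_main (hn : 1 ≤ n) (hG : IsChordal G) (hk : 1 ≤ k) :
    Halts (k * bitBound.eval n)
      (2 * k * (Prog.integerPart.cost + Prog.bisect.cost + 4).eval n) Prog.main (input G k)
      (fun s => ∃ c : ℕ, s.output = (c : ℚ) / 2 ^ k ∧ (c : ℝ) / 2 ^ k ≤ fracHatNumber G ∧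
        fracHatNumber G < ((c : ℝ) + 1) / 2 ^ k) := by
  have hb := smallOk_bitBound (n := n) hk
  have : Nonempty (Fin n) := ⟨⟨0, hn⟩⟩
  have hcard : fracHatNumber G ≤ n := by simpa using fracHatNumber_le_card G
  have hbk : ∀ j ≤ k, bitLength (j : ℚ) ≤ k * bitBound.eval n := by
    intro j hj
    refine (bitLength_natCast_le hj).trans ?_
    rw [bitBound_eval]
    nlinarith
  suffices h : Halts (k * bitBound.eval n) (Prog.integerPart.cost.eval n +
      ((k * (Prog.bisect.cost.eval n + 2) + 1) + 1)) Prog.main (input G k)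
      (fun s => ∃ c : ℕ, s.output = (c : ℚ) / 2 ^ k ∧ (c : ℝ) / 2 ^ k ≤ fracHatNumber G ∧
        fracHatNumber G < ((c : ℝ) + 1) / 2 ^ k) by
    -- As `k ≥ 1`, the cost that does not depend on `k` is absorbed by the factor `2 * k`.
    refine h.mono ?_ fun s' hs' _ => hs'
    simp only [Polynomial.eval_add, Polynomial.eval_ofNat]
    nlinarith
  refine Halts.seq (Halts.mono (does_integerPart hn hG hk) le_rfl fun s₁ h₁ _ => Halts.seq ?_)
  obtain ⟨H₁, e1, e14, e21, e22, ⟨L, hL, hl, ho⟩, c, e13, hle, hlt⟩ := h₁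
  -- This loop has `k` rounds instead of `n`, so it is counted directly and not through `Prog.cost`.
  refine (Halts.count (T := Prog.bisect.cost.eval n) (fun j s => ∃ c : ℕ,
      s.reg 13 = (c : ℚ) / 2 ^ j ∧ s.reg 14 = 1 / 2 ^ j ∧ (c : ℝ) / 2 ^ j ≤ fracHatNumber G ∧
      fracHatNumber G < ((c : ℝ) + 1) / 2 ^ j)
    (by decide) (by decide) (by decide) (by decide) (by decide) hbk e1 H₁.one e22
    (fun j s q h => by simpa using h)
    ⟨c, by simpa using e13, by simpa using e14, by simpa using hle, by simpa using hlt⟩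
    (fun j hj s₂ h₂ _ f₂ => ?_)).mono le_rfl fun s₂ h₂ f₂ => ?_
  · obtain ⟨c, h13, h14, hle, hlt⟩ := h₂
    exact does_bisect hn hk (H₁.frame f₂ (by decide)) hL hl (ho.frame f₂ rfl)
      (by rw [f₂.reg 21 rfl, e21]) hj h13 h14 hle hlt
  · obtain ⟨c, h13, -, hle, hlt⟩ := h₂
    have e3 : s₂.reg 3 = 0 := (H₁.frame f₂ (by decide)).zero
    have hbit : bitLength ((c : ℚ) / 2 ^ k) ≤ k * bitBound.eval n := by
      rcases Nat.eq_zero_or_pos c with rfl | hc0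
      · simpa using hb.zero
      · refine (hl.dyadic_ok hL hk le_rfl hc0 ?_).1
        have := hle.trans hcard
        rw [div_le_iff₀ (by positivity)] at this
        have : c ≤ n * 2 ^ k := by exact_mod_cast this
        nlinarith
    have hout : Does (k * bitBound.eval n) n (.arith .add 0 13 3) s₂ (fun s => ∃ c : ℕ,
        s.output = (c : ℚ) / 2 ^ k ∧ (c : ℝ) / 2 ^ k ≤ fracHatNumber G ∧
        fracHatNumber G < ((c : ℝ) + 1) / 2 ^ k) :=
      Does.arith ((c : ℚ) / 2 ^ k) (by simp [Op.eval, h13, e3]) hbit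
        ⟨c, by simp [State.output], hle, hlt⟩
    exact Halts.mono hout (by simp [Prog.cost]) fun s' hs' _ => hs'

/-- A chordal graph has an elimination order. -/
theorem IsChordal.exists_isElimOrder (hG : IsChordal G) :
    ∃ L : List (Fin n), (∀ v, v ∈ L) ∧ IsElimOrder G L := by
  classical
  suffices h : ∀ U : Finset (Fin n), ∃ L : List (Fin n), (∀ v, v ∈ L ↔ v ∈ U) ∧
      IsElimOrder G L by
    obtain ⟨L, hL, hl⟩ := h Finset.univ
    exact ⟨L, fun v => (hL v).2 (Finset.mem_univ v), hl⟩
  intro U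
  induction U using Finset.strongInduction with
  | H U ih =>
  rcases U.eq_empty_or_nonempty with rfl | hU
  · exact ⟨[], by simp, trivial⟩
  · obtain ⟨z, hz, hzs⟩ := hG.exists_isSimplicialIn U hU
    obtain ⟨L, hL, hl⟩ := ih (U.erase z) (Finset.erase_ssubset hz)
    refine ⟨z :: L, fun v => ?_, fun h => by simpa using (hL z).1 h, fun a ha b hb => ?_, hl⟩
    · rw [List.mem_cons, hL, Finset.mem_erase]
      by_cases hv : v = z
      · simp [hv, hz]
      · simp [hv]
    · exact hzs a (Finset.mem_of_mem_erase ((hL a).1 ha)) b (Finset.mem_of_mem_erase ((hL b).1 hb))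

end Main

end HatGuessing

theorem theorem6 :
    ∃ (A : HatGuessing.Prog) (p q : Polynomial ℕ),
      ∀ (n : ℕ), 1 ≤ n → ∀ (G : SimpleGraph (Fin n)), HatGuessing.IsChordal G →
        ∀ (k : ℕ), 1 ≤ k →
          ∃ (t : ℕ) (s : HatGuessing.State),
            HatGuessing.Run (k * q.eval n) A (HatGuessing.input G k) t s ∧
            t ≤ 2 * k * p.eval n ∧
            |(s.output : ℝ) - HatGuessing.fracHatNumber G| ≤ 1 / 2 ^ k ∧
            ((∃ r : ℚ, HatGuessing.fracHatNumber G = (r : ℝ)) →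
              (s.output : ℝ) = HatGuessing.fracHatNumber G ∧
              ∃ m : ℕ, HatGuessing.fracHatNumber G = (m : ℝ)) := by
  refine ⟨HatGuessing.Prog.main,
    HatGuessing.Prog.integerPart.cost + HatGuessing.Prog.bisect.cost + 4,
    HatGuessing.bitBound, fun n hn G hG k hk => ?_⟩
  obtain ⟨t, s, hrun, ht, c, hout, hle, hlt⟩ := HatGuessing.halts_main hn hG hk
  have : Nonempty (Fin n) := ⟨⟨0, hn⟩⟩
  have hpow : (0 : ℝ) < 2 ^ k := by positivity
  have houtR : (s.output : ℝ) = (c : ℝ) / 2 ^ k := by rw [hout]; push_cast; rfl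
  refine ⟨t, s, hrun, ht, ?_, ?_⟩
  · rw [houtR, abs_le]
    rw [add_div] at hlt
    constructor
    · linarith
    · have : (0 : ℝ) < 1 / 2 ^ k := by positivity
      linarith
  · rintro ⟨r, hr⟩
    obtain ⟨L, hall, hl⟩ := hG.exists_isElimOrder
    obtain ⟨m, hm⟩ := hl.fracHatNumber_eq_natCast hall hr
    refine ⟨?_, m, hm⟩
    rw [hm] at hle hlt
    rw [div_le_iff₀ hpow] at hle
    rw [lt_div_iff₀ hpow] at hlt
    -- The integer `m * 2 ^ k` lies in `[c, c + 1)`, so it equals `c` and rounding down lost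
    -- nothing.
    have h1 : c ≤ m * 2 ^ k := by exact_mod_cast hle
    have h2 : m * 2 ^ k < c + 1 := by exact_mod_cast hlt
    have h3 : c = m * 2 ^ k := by omega
    rw [houtR, hm, h3]
    push_cast
    field_simp
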